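/- **Setting.** Let $q\ge 1$, $n\ge 0$, and consider $n$ qudits of local dimension $q$, with Hilbert space $\mathcal H=(\mathbb C^q)^{\otimes n}$ and computational basis $|y\rangle$, $y\in(\mathbb Z/q)^n$. The Pauli group is the group of unitaries generated by $X_i|y\rangle=|y+e_i\rangle$, $Z_i|y\rangle=e^{2\pi i y_i/q}|y\rangle$ and the phase $e^{\pi i/q}\cdot 1$. A Pauli stabilizer code is the simultaneous $+1$ eigenspace $\mathcal C\subseteq\mathcal H$ of an abelian subgroup $S$ of the Pauli group. Let $V:\mathcal H_L=\mathbb C^K\to\mathcal H$ be an isometry with range $\mathcal C$; the von Neumann algebra $M_{\mathcal C}$ of the code is the algebra $L(\mathcal H_L)$ of all logical operators. For a set $A$ of physical qudits with complement $\bar A$, so $\mathcal H=\mathcal H_A\otimes\mathcal H_{\bar A}$, let $M_A\subseteq M_{\mathcal C}$ be the $*$-algebra of logical operators supported on $A$, i.e. those $T$ for which some $O\in L(\mathcal H_A)$ satisfies $(O\otimes 1)V=VT$ and $(O\otimes 1)^\dagger V=VT^\dagger$. **Area operators.** A *complementary recovery decomposition* for $A,\bar A$ consists of an orthonormal basis $|\alpha,ij\rangle$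 of $\mathcal H_L$ giving a Wedderburn decomposition $\mathcal H_L=\bigoplus_\alpha\mathcal H_{a^\alpha}\otimes\mathcal H_{\bar a^\alpha}$ in which $M_A$ is exactly the set of operators $\bigoplus_\alpha O_\alpha\otimes 1$, of isometries $U_A:\bigoplus_\alpha\mathcal H_{A_1^\alpha}\otimes\mathcal H_{A_2^\alpha}\to\mathcal H_A$ and $U_{\bar A}:\bigoplus_\alpha\mathcal H_{\bar A_1^\alpha}\otimes\mathcal H_{\bar A_2^\alpha}\to\mathcal H_{\bar A}$ with $\dim\mathcal H_{A_1^\alpha}=\dim\mathcal H_{a^\alpha}$ and $\dim\mathcal H_{\bar A_1^\alpha}=\dim\mathcal H_{\bar a^\alpha}$, and of unit vectors $|\chi_\alpha\rangle\in\mathcal H_{A_2^\alpha}\otimes\mathcal H_{\bar A_2^\alpha}$, such that $$V|\alpha,ij\rangle=(U_A\otimes U_{\bar A})\big(|\alpha,i\rangle_{A_1^\alpha}|\alpha,j\rangle_{\bar A_1^\alpha}|\chi_\alpha\rangle_{A_2^\alpha\bar A_2^\alpha}\big).$$ Its *area operator* is $\mathcal L_A=\bigoplus_\alpha S(\chi_\alpha)\,1_{a^\alpha\bar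 a^\alpha}$, where $\chi_\alpha=\operatorname{Tr}_{\bar A_2^\alpha}|\chi_\alpha\rangle\langle\chi_\alpha|$ and $S$ is the von Neumann entropy. **Theorem.** For every Pauli stabilizer code, every encoding $V$ of it and every bipartition $A,\bar A$ of the physical qudits: 1. complementary recovery holds, $M_A'=M_{\bar A}$ (commutant in $M_{\mathcal C}$), and a complementary recovery decomposition exists; 2. for every such decomposition and every logical state $\rho$, $\mathcal L_A$ satisfies the RT-type formula $S(\operatorname{Tr}_{\bar A}[V\rho V^\dagger])=S(M_A;\rho)+\operatorname{Tr}[\mathcal L_A\rho]$, where $S(M_A;\rho)=-\sum_\alpha\operatorname{Tr}\big(\rho_\alpha\log\rho_\alpha\big)$ and $\rho_\alpha$ is the partial trace over $\mathcal H_{\bar a^\alpha}$ of the compression of $\rho$ to block $\alpha$; 3. every area operator is proportional to the logical identity: there is one real constant $c$ with $\mathcal L_A=c\cdot 1$ for all such decompositions. No assumption is made on the center $Z(M_A)$, which may be non-trivial. -/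

import Mathlib

open scoped ComplexConjugate Kronecker ComplexOrder

namespace PauliCode

noncomputable section

/-! ### Qudits and the Pauli group -/

/-- Computational basis labels of a register of qudits of local dimension `q`, indexed by `ι`. The
Hilbert space `H = (ℂ^q)^{⊗ ι}` is the space of complex functions on it. -/
abbrev Config (q : ℕ) (ι : Type) : Type := ι → ZMod q

/-- Operators on a register of qudits, as matrices in the computational basis. -/
abbrev Op (q : ℕ) (ι : Type) : Type := Matrix (Config q ι) (Config q ι) ℂ

/-- The primitive `q`-th root of unity `ω = exp(2πi/q)`. -/
def rootOfUnity (q : ℕ) : ℂ := Complex.exp (2 * Real.pi * Complex.I / q)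

/-- The phase `τ = exp(πi/q)`, a square root of `ω` (for qubits, `τ = i`). -/
def phase (q : ℕ) : ℂ := Complex.exp (Real.pi * Complex.I / q)

/-- The shift operator on qudit `i`: `X_i |y⟩ = |y + e_i⟩`. -/
def shiftX (q n : ℕ) (i : Fin n) : Op q (Fin n) :=
  Matrix.of fun x y => if x = y + Pi.single i 1 then 1 else 0

/-- The clock operator on qudit `i`: `Z_i |y⟩ = ω ^ {y_i} |y⟩`. -/
def clockZ (q n : ℕ) (i : Fin n) : Op q (Fin n) :=
  Matrix.diagonal fun y => rootOfUnity q ^ (y i).val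

set_option linter.unusedSectionVars false

variable {q n : ℕ} [NeZero q]

theorem conj_exp_mul_self (r : ℝ) (k : ℕ) :
    conj (Complex.exp (r * Complex.I) ^ k) * Complex.exp (r * Complex.I) ^ k = 1 := by
  rw [← Complex.normSq_eq_conj_mul_self, Complex.normSq_eq_norm_sq, norm_pow,
    Complex.norm_exp_ofReal_mul_I]
  simp

theorem shiftX_mem (i : Fin n) :
    shiftX q n i ∈ Matrix.unitaryGroup (Config q (Fin n)) ℂ := by
  rw [Matrix.mem_unitaryGroup_iff']
  ext x y
  simp only [shiftX, Matrix.star_eq_conjTranspose, Matrix.mul_apply, Matrix.conjTranspose_apply,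
    Matrix.of_apply, Matrix.one_apply]
  rw [Finset.sum_eq_single (y + Pi.single i 1)]
  · by_cases h : x = y <;> simp [h, eq_comm]
  · intro b _ hb
    simp [hb]
  · simp

theorem clockZ_mem (i : Fin n) :
    clockZ q n i ∈ Matrix.unitaryGroup (Config q (Fin n)) ℂ := by
  rw [Matrix.mem_unitaryGroup_iff', clockZ, Matrix.star_eq_conjTranspose,
    Matrix.diagonal_conjTranspose, Matrix.diagonal_mul_diagonal, ← Matrix.diagonal_one]
  congr 1
  funext y
  have h := conj_exp_mul_self (2 * Real.pi / q) (y i).val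
  have e : ((2 * Real.pi / q : ℝ) : ℂ) * Complex.I = 2 * Real.pi * Complex.I / q := by
    push_cast; ring
  rw [e] at h
  simpa [rootOfUnity] using h

theorem phase_mem :
    (phase q • 1 : Op q (Fin n)) ∈ Matrix.unitaryGroup (Config q (Fin n)) ℂ := by
  rw [Matrix.mem_unitaryGroup_iff', Matrix.star_eq_conjTranspose, Matrix.conjTranspose_smul,
    Matrix.conjTranspose_one, smul_mul_smul_comm, mul_one]
  have h := conj_exp_mul_self (Real.pi / q) 1
  have e : ((Real.pi / q : ℝ) : ℂ) * Complex.I = Real.pi * Complex.I / q := by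
    push_cast; ring
  rw [e, pow_one] at h
  have h' : star (phase q) * phase q = 1 := h
  rw [h', one_smul]

variable (q n) in
/-- The Pauli group on `n` qudits of local dimension `q`: the group of unitaries generated by the
phase `τ` and the operators `X_i`, `Z_i`. -/
def pauliGroup : Subgroup (Matrix.unitaryGroup (Config q (Fin n)) ℂ) :=
  Subgroup.closure
    ({⟨phase q • 1, phase_mem⟩} ∪ Set.range (fun i => ⟨shiftX q n i, shiftX_mem i⟩) ∪
      Set.range (fun i => ⟨clockZ q n i, clockZ_mem i⟩))

/-- The code space of a group of unitaries: its simultaneous `+1` eigenspace. -/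
def codeSpace (S : Subgroup (Matrix.unitaryGroup (Config q (Fin n)) ℂ)) :
    Submodule ℂ (Config q (Fin n) → ℂ) where
  carrier := {ψ | ∀ U ∈ S, (U : Op q (Fin n)).mulVec ψ = ψ}
  add_mem' := fun ha hb U hU => by rw [Matrix.mulVec_add, ha U hU, hb U hU]
  zero_mem' := fun U _ => Matrix.mulVec_zero _
  smul_mem' := fun c x hx U hU => by rw [Matrix.mulVec_smul, hx U hU]

/-- `V` is an isometric encoding map `ℂ^K → H` onto the stabilizer code of `S`: its columns form an
orthonormal basis of the code space. The logical operators are then the `K × K` matrices. -/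
structure IsEncoding {K : ℕ} (S : Subgroup (Matrix.unitaryGroup (Config q (Fin n)) ℂ))
    (V : Matrix (Config q (Fin n)) (Fin K) ℂ) : Prop where
  isometry : V.conjTranspose * V = 1
  range_eq : LinearMap.range V.mulVecLin = codeSpace S

/-! ### Bipartitions -/

/-- Splitting a basis label along the bipartition `A`, `Aᶜ` of the qudits. -/
def split (q : ℕ) {n : ℕ} (A : Finset (Fin n)) :
    Config q (Fin n) ≃ Config q A × Config q (Aᶜ : Finset (Fin n)) where
  toFun x := (A.restrict x, Aᶜ.restrict x)
  invFun p := fun i =>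
    if h : i ∈ A then p.1 ⟨i, h⟩ else p.2 ⟨i, Finset.mem_compl.2 h⟩
  left_inv x := by
    funext i
    by_cases h : i ∈ A <;> simp [h]
  right_inv p := by
    ext i
    · simp
    · have := Finset.mem_compl.1 i.2
      simp [this]

/-- The operator `O ⊗ 1_Ā` on the full register, for an operator `O` on `H_A`. -/
def localOp (A : Finset (Fin n)) (O : Op q A) : Op q (Fin n) :=
  (O ⊗ₖ (1 : Op q (Aᶜ : Finset (Fin n)))).submatrix (split q A) (split q A)

/-- The partial trace over `Ā`: the reduced operator on `H_A`. -/
def partialTrace (A : Finset (Fin n)) (M : Op q (Fin n)) : Op q A :=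
  Matrix.of fun a a' => ∑ b, M ((split q A).symm (a, b)) ((split q A).symm (a', b))

theorem localOp_mul (A : Finset (Fin n)) (O P : Op q A) :
    localOp A (O * P) = localOp A O * localOp A P := by
  rw [localOp, localOp, localOp, Matrix.submatrix_mul_equiv, ← Matrix.mul_kronecker_mul, mul_one]

theorem localOp_add (A : Finset (Fin n)) (O P : Op q A) :
    localOp A (O + P) = localOp A O + localOp A P := by
  rw [localOp, Matrix.add_kronecker]; rfl

theorem localOp_smul_one (A : Finset (Fin n)) (c : ℂ) :
    localOp A (c • (1 : Op q A)) = c • 1 := by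
  rw [localOp, Matrix.smul_kronecker, Matrix.one_kronecker_one, Matrix.submatrix_smul]
  simp

theorem localOp_conjTranspose (A : Finset (Fin n)) (O : Op q A) :
    localOp A O.conjTranspose = (localOp A O).conjTranspose := by
  rw [localOp, localOp, Matrix.conjTranspose_submatrix, Matrix.conjTranspose_kronecker,
    Matrix.conjTranspose_one]

/-! ### The code subalgebra supported on a subregion -/

/-- The algebra `M_A` of logical operators that can be represented on `A`: those `T` on the logical
space for which some operator `O` on `H_A` satisfies `(O ⊗ 1) V = V T` and `(O ⊗ 1)† V = V T†`. -/
def codeAlgebra {K : ℕ} (V : Matrix (Config q (Fin n)) (Fin K) ℂ) (A : Finset (Fin n)) :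
    StarSubalgebra ℂ (Matrix (Fin K) (Fin K) ℂ) where
  carrier := {T | ∃ O : Op q A, localOp A O * V = V * T ∧
    (localOp A O).conjTranspose * V = V * T.conjTranspose}
  mul_mem' := by
    rintro T T' ⟨O, h1, h2⟩ ⟨O', h1', h2'⟩
    refine ⟨O * O', ?_, ?_⟩
    · rw [localOp_mul, Matrix.mul_assoc, h1', ← Matrix.mul_assoc, h1, Matrix.mul_assoc]
    · rw [localOp_mul, Matrix.conjTranspose_mul, Matrix.mul_assoc, h2, ← Matrix.mul_assoc, h2',
        Matrix.mul_assoc, Matrix.conjTranspose_mul]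
  add_mem' := by
    rintro T T' ⟨O, h1, h2⟩ ⟨O', h1', h2'⟩
    refine ⟨O + O', ?_, ?_⟩
    · rw [localOp_add, Matrix.add_mul, Matrix.mul_add, h1, h1']
    · rw [localOp_add, Matrix.conjTranspose_add, Matrix.conjTranspose_add, Matrix.add_mul,
        Matrix.mul_add, h2, h2']
  algebraMap_mem' := by
    intro c
    refine ⟨c • 1, ?_, ?_⟩ <;> rw [localOp_smul_one, Algebra.algebraMap_eq_smul_one] <;> simp
  star_mem' := by
    rintro T ⟨O, h1, h2⟩
    refine ⟨O.conjTranspose, ?_, ?_⟩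
    · rw [localOp_conjTranspose, h2, Matrix.star_eq_conjTranspose]
    · rw [localOp_conjTranspose, Matrix.conjTranspose_conjTranspose, h1,
        Matrix.star_eq_conjTranspose, Matrix.conjTranspose_conjTranspose]

/-! ### Complementary recovery and the area operator -/

open scoped Classical in
/-- The von Neumann entropy `-Tr (M log M)` of a Hermitian matrix (natural logarithm,
`0 log 0 = 0`). -/
def entropy {m : Type} [Fintype m] [DecidableEq m] (M : Matrix m m ℂ) : ℝ :=
  if h : M.IsHermitian then ∑ k, Real.negMulLog (h.eigenvalues k) else 0

/-- A decomposition exhibiting complementary recovery of the code with encoding map `V` for the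
bipartition `A`, `Ā`: the Wedderburn decomposition `⨁_α H_{a^α} ⊗ H_{ā^α}` of the logical space
induced by `M_A`, with orthonormal basis `|α, i j⟩`, such that
`V |α, i j⟩ = (U_A ⊗ U_Ā) (|α, i⟩ |α, j⟩ |χ_α⟩)` for isometries
`U_A : ⨁_α H_{A₁^α} ⊗ H_{A₂^α} → H_A` and `U_Ā : ⨁_α H_{Ā₁^α} ⊗ H_{Ā₂^α} → H_Ā`, where
`dim H_{A₁^α} = dim H_{a^α}` and `dim H_{Ā₁^α} = dim H_{ā^α}`, and unit vectors
`|χ_α⟩ ∈ H_{A₂^α} ⊗ H_{Ā₂^α}`. -/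
structure Decomposition {K : ℕ} (V : Matrix (Config q (Fin n)) (Fin K) ℂ)
    (A : Finset (Fin n)) where
  /-- the number of blocks `α` -/
  numBlocks : ℕ
  /-- the dimension of `H_{a^α}` -/
  dimA₁ : Fin numBlocks → ℕ
  /-- the dimension of `H_{ā^α}` -/
  dimB₁ : Fin numBlocks → ℕ
  /-- the dimension of `H_{A₂^α}` -/
  dimA₂ : Fin numBlocks → ℕ
  /-- the dimension of `H_{Ā₂^α}` -/
  dimB₂ : Fin numBlocks → ℕ
  dimA₁_pos : ∀ α, 0 < dimA₁ α
  dimB₁_pos : ∀ α, 0 < dimB₁ α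
  /-- the matrix whose columns are the logical basis vectors `|α, i j⟩` -/
  basis : Matrix (Fin K) (Σ α, Fin (dimA₁ α) × Fin (dimB₁ α)) ℂ
  basis_orthonormal : basis.conjTranspose * basis = 1
  basis_complete : basis * basis.conjTranspose = 1
  /-- in this basis `M_A` consists of the operators `⨁_α O_α ⊗ 1` -/
  mem_algebra : ∀ T : Matrix (Fin K) (Fin K) ℂ, T ∈ codeAlgebra V A ↔
    ∃ O : ∀ α, Matrix (Fin (dimA₁ α)) (Fin (dimA₁ α)) ℂ,
      T * basis = basis * Matrix.blockDiagonal' fun α =>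
        O α ⊗ₖ (1 : Matrix (Fin (dimB₁ α)) (Fin (dimB₁ α)) ℂ)
  /-- the isometry `U_A` -/
  isoA : Matrix (Config q A) (Σ α, Fin (dimA₁ α) × Fin (dimA₂ α)) ℂ
  isoA_isometry : isoA.conjTranspose * isoA = 1
  /-- the isometry `U_Ā` -/
  isoB : Matrix (Config q (Aᶜ : Finset (Fin n))) (Σ α, Fin (dimB₁ α) × Fin (dimB₂ α)) ℂ
  isoB_isometry : isoB.conjTranspose * isoB = 1
  /-- the coefficients `⟨s t | χ_α⟩` of the states `χ_α` -/
  χ : ∀ α, Matrix (Fin (dimA₂ α)) (Fin (dimB₂ α)) ℂ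
  χ_unit : ∀ α, ∑ s, ∑ t, ‖χ α s t‖ ^ 2 = 1
  encoded_basis : ∀ x α i j, (V * basis) x ⟨α, (i, j)⟩ =
    ∑ s, ∑ t, χ α s t * (isoA (split q A x).1 ⟨α, (i, s)⟩ * isoB (split q A x).2 ⟨α, (j, t)⟩)

namespace Decomposition

variable {K : ℕ} {V : Matrix (Config q (Fin n)) (Fin K) ℂ} {A : Finset (Fin n)}
  (D : Decomposition V A)

/-- The reduced state `χ_α = Tr_{Ā₂^α} |χ_α⟩⟨χ_α|` on `A₂^α`. -/
def reducedχ (α : Fin D.numBlocks) : Matrix (Fin (D.dimA₂ α)) (Fin (D.dimA₂ α)) ℂ :=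
  Matrix.of fun s s' => ∑ t, D.χ α s t * conj (D.χ α s' t)

/-- The area operator `L_A = ⨁_α S(χ_α) 1`. -/
def areaOperator : Matrix (Fin K) (Fin K) ℂ :=
  D.basis * (Matrix.diagonal (fun k => (entropy (D.reducedχ k.1) : ℂ)) :
    Matrix (Σ α, Fin (D.dimA₁ α) × Fin (D.dimB₁ α)) _ ℂ) * D.basis.conjTranspose

/-- The (unnormalised) block `p_α ρ_{a^α}` of a logical operator `ρ`: compress to block `α` and
trace out `H_{ā^α}`. -/
def block (ρ : Matrix (Fin K) (Fin K) ℂ) (α : Fin D.numBlocks) :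
    Matrix (Fin (D.dimA₁ α)) (Fin (D.dimA₁ α)) ℂ :=
  Matrix.of fun i i' =>
    ∑ j, (D.basis.conjTranspose * ρ * D.basis) ⟨α, (i, j)⟩ ⟨α, (i', j)⟩

/-- The algebraic entropy `S(M_A; ρ) = -∑_α Tr (p_α ρ_{a^α} log (p_α ρ_{a^α}))`. -/
def algebraicEntropy (ρ : Matrix (Fin K) (Fin K) ℂ) : ℝ := ∑ α, entropy (D.block ρ α)

end Decomposition

end

end PauliCode

/-!
Write `W̄ = Vᴴ W V` for the compression of an operator to the code. Everything rests on one
dichotomy, `IsEncoding.isLogical_or`: a Weyl operator `W = X^a Z^b` commutes with every stabilizer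
up to a phase; if all phases are trivial, `W` preserves the code and `W̄` is unitary, and
otherwise `W` maps the code to an orthogonal subspace and `W̄ = 0`. Since Weyl operators on `A`
span `L(H_A)`, it follows that `M_A` is the full compression `Vᴴ L(H_A) V`
(`mem_codeAlgebra_iff`).

*Complementary recovery.* `M_Ā ⊆ M_A'` because operators on `A` and `Ā` commute. Conversely, for
`T ∈ M_A'`, the twirl of `V T Vᴴ` over the Weyl operators on `A` is an operator on `Ā`, and its
compression is a positive multiple of `T` (`mem_codeAlgebra_compl_of_commute`).

*Decompositions.* A Wedderburn basis of `M_A` (`exists_wedderburn`) and the matrix units of `M_A`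
and of its commutant `M_Ā`, implemented on `A` and `Ā`, generate all encoded basis vectors from
`V |α, 0 0⟩`; this yields the isometries and the states `χ_α` (`nonempty_decomposition`). For any
decomposition the reduced state on `A` is `⨁_α ρ_α ⊗ χ_α` up to an isometry
(`Decomposition.partialTrace_encoded`), and the Ryu–Takayanagi formula is the additivity of the
entropy.

*The area constant.* The operator `R = Tr_Ā (V Vᴴ)` satisfies `R² = μ R`
(`partialTrace_codeProjection_sq`), which forces `χ_α` to have a flat spectrum with nonzero
eigenvalue `μ / dim H_{ā^α}`. It remains to see that all blocks have equal dimensions. The Weyl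
operators in `M_A`, and those in its center, are tight frames of these algebras
(`sum_trace_smul_logical`); expanding a matrix unit and a block projection in them determines
`dim H_{a^α} / dim H_{ā^α}` and `dim H_{a^α} · dim H_{ā^α}` by counts of Weyl operators that
involve neither `α` nor the decomposition.
-/

open scoped ComplexConjugate Kronecker ComplexOrder

namespace PauliCode

open Matrix

set_option linter.unusedSectionVars false

/-! ### Minimal projections of a matrix star-algebra -/

section LinearAlgebra

variable {m : Type*} [Fintype m] [DecidableEq m]

/-- A subspace of `ℂ^m` has an orthonormal basis, arranged as the columns of a matrix. -/
theorem exists_orthonormal_columns (U : Submodule ℂ (m → ℂ)) :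
    ∃ (r : ℕ) (a : Matrix m (Fin r) ℂ), aᴴ * a = 1 ∧ (∀ i, (fun x => a x i) ∈ U) ∧
      ∀ u ∈ U, a *ᵥ (aᴴ *ᵥ u) = u := by
  let U' : Submodule ℂ (EuclideanSpace ℂ m) :=
    U.map (WithLp.linearEquiv 2 ℂ (m → ℂ)).symm.toLinearMap
  let b := stdOrthonormalBasis ℂ U'
  have hinner : ∀ i (u : EuclideanSpace ℂ m), inner ℂ (b i : EuclideanSpace ℂ m) u =
      ((Matrix.of fun x k => (b k : EuclideanSpace ℂ m) x)ᴴ *ᵥ u.ofLp) i := by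
    intro i u
    rw [EuclideanSpace.inner_eq_star_dotProduct, dotProduct_comm]
    rfl
  refine ⟨_, Matrix.of fun x i => (b i : EuclideanSpace ℂ m) x, ?_, ?_, ?_⟩
  · ext i j
    have h := orthonormal_iff_ite.1 b.orthonormal i j
    rw [Submodule.coe_inner, hinner] at h
    rw [Matrix.one_apply, ← h]
    rfl
  · intro i
    obtain ⟨u, hu, hb⟩ := (b i).2
    have : (fun x => (b i : EuclideanSpace ℂ m) x) = u := by
      rw [← hb]; rfl
    simpa [this] using hu
  · intro u hu
    have h := b.sum_repr ⟨WithLp.toLp 2 u, u, hu, rfl⟩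
    have h2 := congrArg (fun v : U' => (v : EuclideanSpace ℂ m).ofLp) h
    simp only [b.repr_apply_apply, Submodule.coe_inner, hinner] at h2
    rw [Submodule.coe_sum, WithLp.ofLp_sum] at h2
    funext x
    have h3 := congrFun h2 x
    rw [Finset.sum_apply] at h3
    rw [← h3]
    simp only [mulVec, dotProduct]
    refine Finset.sum_congr rfl fun i _ => ?_
    exact mul_comm _ _

/-- An orthonormal basis `a` of the range of `M`, with `a = M v` recording that its columns lie in
the range. -/
theorem exists_orthonormal_range {l : Type*} [Fintype l] [DecidableEq l] (M : Matrix m l ℂ) :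
    ∃ (r : ℕ) (a : Matrix m (Fin r) ℂ) (v : Matrix l (Fin r) ℂ),
      aᴴ * a = 1 ∧ a = M * v ∧ a * aᴴ * M = M := by
  obtain ⟨r, a, h1, h2, h3⟩ := exists_orthonormal_columns (LinearMap.range M.mulVecLin)
  choose v hv using h2
  refine ⟨r, a, Matrix.of fun x i => v i x, h1, ?_, ?_⟩
  · ext x i
    exact (congrFun (hv i) x).symm
  · ext x y
    have := congrFun (h3 (fun x => M x y) ⟨Pi.single y 1, by ext; simp⟩) x
    rw [mulVec_mulVec] at this
    exact this

theorem rank_lt_of_mulVec {z p : Matrix m m ℂ} (hker : ∀ u, p *ᵥ u = 0 → z *ᵥ u = 0)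
    {v : m → ℂ} (hz : z *ᵥ v = 0) (hp : p *ᵥ v ≠ 0) : z.rank < p.rank := by
  have hlt : LinearMap.ker p.mulVecLin < LinearMap.ker z.mulVecLin := by
    refine lt_of_le_of_ne (fun u hu => hker u hu) fun h => hp ?_
    have : v ∈ LinearMap.ker z.mulVecLin := hz
    rw [← h] at this
    exact this
  have h1 := Submodule.finrank_lt_finrank_of_lt hlt
  have h2 := p.mulVecLin.finrank_range_add_finrank_ker
  have h3 := z.mulVecLin.finrank_range_add_finrank_ker
  simp only [Matrix.rank]
  omega

/-- `p` is a minimal projection of the algebra `M`: a nonzero projection with `p M p = ℂ p`. -/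
structure IsMinimalProjection (M : StarSubalgebra ℂ (Matrix m m ℂ)) (p : Matrix m m ℂ) :
    Prop where
  mem : p ∈ M
  ne_zero : p ≠ 0
  isHermitian : pᴴ = p
  idem : p * p = p
  scalar : ∀ x ∈ M, ∃ c : ℂ, p * x * p = c • p

/-- Below a nonzero projection `Q ∈ M` there is a minimal projection of `M`. A nonzero `x ∈ Q M` of
least rank does the work: any element of `Q M` built from `x` with a larger kernel must vanish. This
turns `x xᴴ` into a multiple of a projection `p`, and every `p y p` into a multiple of `p`. -/
theorem exists_minimalProjection (M : StarSubalgebra ℂ (Matrix m m ℂ)) {Q : Matrix m m ℂ}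
    (hQM : Q ∈ M) (hQ0 : Q ≠ 0) (hQ : Q * Q = Q) :
    ∃ p, IsMinimalProjection M p ∧ Q * p = p := by
  classical
  -- a nonzero element `x` of the right ideal `Q M` of least possible rank
  let P : ℕ → Prop := fun r => ∃ x ∈ M, x ≠ 0 ∧ Q * x = x ∧ x.rank = r
  have hex : ∃ r, P r := ⟨_, Q, hQM, hQ0, hQ, rfl⟩
  obtain ⟨x, hxM, hx0, hQx, hxr⟩ := Nat.find_spec hex
  have hmin : ∀ y ∈ M, Q * y = y → y.rank < x.rank → y = 0 := by
    intro y hyM hQy hlt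
    by_contra hy
    exact Nat.find_min hex (hxr ▸ hlt) ⟨y, hyM, hy, hQy, rfl⟩
  have hxM' : xᴴ ∈ M := star_mem hxM
  set h := x * xᴴ with hh
  have hhM : h ∈ M := M.mul_mem hxM hxM'
  have hhH : h.IsHermitian := isHermitian_mul_conjTranspose_self x
  have hh0 : h ≠ 0 := fun h0 => hx0 (Matrix.self_mul_conjTranspose_eq_zero.1 h0)
  have hrank : h.rank = x.rank := rank_self_mul_conjTranspose x
  have hQh : Q * h = h := by rw [hh, ← Matrix.mul_assoc, hQx]
  obtain ⟨v, l, hi, hv0, hhv⟩ := hhH.exists_eigenvector_of_ne_zero hh0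
  replace hhv : h *ᵥ v = (l : ℂ) • v := hhv
  have hlC : (l : ℂ) ≠ 0 := by exact_mod_cast hi
  -- `h * h - l • h` kills the eigenvector `v` as well as `ker h`, so its rank is too small
  have hsq : h * h = (l : ℂ) • h := by
    rw [← sub_eq_zero]
    refine hmin _ (M.sub_mem (M.mul_mem hhM hhM) (M.smul_mem hhM _)) ?_ ?_
    · rw [Matrix.mul_sub, ← Matrix.mul_assoc, hQh, Matrix.mul_smul, hQh]
    · rw [← hrank]
      refine rank_lt_of_mulVec (v := v) ?_ ?_ ?_
      · intro u hu
        rw [Matrix.sub_mulVec, ← mulVec_mulVec, hu, smul_mulVec, hu]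
        simp
      · rw [Matrix.sub_mulVec, ← mulVec_mulVec, hhv, smul_mulVec, mulVec_smul, hhv, sub_self]
      · rw [hhv]
        exact smul_ne_zero hlC hv0
  set p := (l : ℂ)⁻¹ • h with hp
  have hpM : p ∈ M := M.smul_mem hhM _
  have hp0 : p ≠ 0 := smul_ne_zero (inv_ne_zero hlC) hh0
  have hpp : p * p = p := by
    rw [hp, smul_mul_smul_comm, hsq, smul_smul, mul_assoc, inv_mul_cancel₀ hlC, mul_one]
  have hpH : pᴴ = p := by
    rw [hp, conjTranspose_smul, hhH.eq]
    simp
  have hQp : Q * p = p := by rw [hp, Matrix.mul_smul, hQh]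
  have hprank : p.rank ≤ x.rank := by
    have : p = h * ((l : ℂ)⁻¹ • 1) := by rw [hp, Matrix.mul_smul, Matrix.mul_one]
    rw [← hrank, this]
    exact rank_mul_le_left _ _
  clear_value p
  refine ⟨p, ⟨hpM, hp0, hpH, hpp, fun y hy => ?_⟩, hQp⟩
  obtain ⟨r, w, z, hw, hwz, hwp⟩ := exists_orthonormal_range p
  have hpw : p * w = w := by rw [hwz, ← Matrix.mul_assoc, hpp]
  have hwp : w * wᴴ = p := by
    have := congrArg conjTranspose hwp
    rw [conjTranspose_mul, hpH, conjTranspose_mul, conjTranspose_conjTranspose,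
      ← Matrix.mul_assoc, hpw] at this
    exact this
  have hr : Nonempty (Fin r) := by
    by_contra hne
    rw [not_nonempty_iff] at hne
    apply hp0
    rw [← hwp]
    ext
    simp [Matrix.mul_apply]
  -- `p y p - c • p` kills an eigenvector of the compression of `y` to the range of `p`
  have hend : ∃ c, Module.End.HasEigenvalue (Matrix.toLin' (wᴴ * y * w)) c :=
    Module.End.exists_eigenvalue _
  obtain ⟨c, hc⟩ := hend
  obtain ⟨u, hu⟩ := hc.exists_hasEigenvector
  have hu1 : (wᴴ * y * w) *ᵥ u = c • u := by
    have := hu.apply_eq_smul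
    rwa [Matrix.toLin'_apply] at this
  refine ⟨c, ?_⟩
  rw [← sub_eq_zero]
  have hwu : w *ᵥ u ≠ 0 := by
    intro h0
    apply hu.2
    have := congrArg (fun t => wᴴ *ᵥ t) h0
    simpa [mulVec_mulVec, hw] using this
  refine hmin _ (M.sub_mem (M.mul_mem (M.mul_mem hpM hy) hpM) (M.smul_mem hpM _)) ?_ ?_
  · rw [Matrix.mul_sub, Matrix.mul_smul, hQp, ← Matrix.mul_assoc, ← Matrix.mul_assoc, hQp]
  · refine lt_of_lt_of_le ?_ hprank
    refine rank_lt_of_mulVec (v := w *ᵥ u) ?_ ?_ ?_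
    · intro t ht
      rw [Matrix.sub_mulVec, ← mulVec_mulVec, ht, smul_mulVec, ht]
      simp
    · have h1 : p * y * p * w = w * (wᴴ * y * w) := by
        rw [Matrix.mul_assoc _ p, hpw]
        simp only [← hwp, Matrix.mul_assoc]
      rw [Matrix.sub_mulVec, mulVec_mulVec, h1, ← mulVec_mulVec, hu1, smul_mulVec,
        mulVec_mulVec, hpw, mulVec_smul, sub_self]
    · rw [mulVec_mulVec, hpw]
      exact hwu

namespace IsMinimalProjection

variable {M : StarSubalgebra ℂ (Matrix m m ℂ)} {p : Matrix m m ℂ}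

theorem exists_isometry (hp : IsMinimalProjection M p) :
    ∃ (b : ℕ) (w : Matrix m (Fin b) ℂ), 0 < b ∧ wᴴ * w = 1 ∧ w * wᴴ = p ∧ p * w = w := by
  obtain ⟨r, w, z, hw, hwz, hwp⟩ := exists_orthonormal_range p
  have hpw : p * w = w := by rw [hwz, ← Matrix.mul_assoc, hp.idem]
  have hwp : w * wᴴ = p := by
    have := congrArg conjTranspose hwp
    rw [conjTranspose_mul, hp.isHermitian, conjTranspose_mul, conjTranspose_conjTranspose,
      ← Matrix.mul_assoc, hpw] at this
    exact this
  refine ⟨r, w, Nat.pos_of_ne_zero ?_, hw, hwp, hpw⟩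
  rintro rfl
  apply hp.ne_zero
  rw [← hwp]
  ext
  simp [Matrix.mul_apply]

/-- The left ideal `M p` has a basis `u` with `uᵢᴴ uⱼ = δᵢⱼ p`. -/
theorem exists_leftIdeal_basis (hp : IsMinimalProjection M p) :
    ∃ (a : ℕ) (u : Fin a → Matrix m m ℂ), 0 < a ∧ (∀ i, u i ∈ M) ∧ (∀ i, u i * p = u i) ∧
      (∀ i i', (u i)ᴴ * u i' = if i = i' then p else 0) ∧
      ∀ x ∈ M, x * p = x → ∑ i, u i * ((u i)ᴴ * x) = x := by
  obtain ⟨b, w, hb, hw, hwp, hpw⟩ := hp.exists_isometry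
  -- evaluation at a unit vector `w₁` in the range of `p` embeds `M p` isometrically
  set w₁ : m → ℂ := fun x => w x ⟨0, hb⟩ with hw₁
  have hpw₁ : p *ᵥ w₁ = w₁ := by
    funext x
    exact congrFun (congrFun hpw x) ⟨0, hb⟩
  have hunit : star w₁ ⬝ᵥ w₁ = 1 := by
    have := congrFun (congrFun hw ⟨0, hb⟩) ⟨0, hb⟩
    rw [one_apply_eq] at this
    exact this
  have hscal : ∀ c : ℂ, star w₁ ⬝ᵥ ((c • p) *ᵥ w₁) = c := by
    intro c
    rw [smul_mulVec, hpw₁, dotProduct_smul, hunit, smul_eq_mul, mul_one]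
  obtain ⟨a, e, he, heU, heS⟩ := exists_orthonormal_columns
    (M.toSubalgebra.toSubmodule.map ((Matrix.mulVecBilin ℂ ℂ).flip w₁))
  choose x hxM hx using heU
  replace hx : ∀ i, x i *ᵥ w₁ = fun y => e y i := hx
  replace hxM : ∀ i, x i ∈ M := hxM
  have hinner : ∀ i (y : Matrix m m ℂ), star w₁ ⬝ᵥ ((p * (x i)ᴴ * y) *ᵥ w₁) =
      (eᴴ *ᵥ (y *ᵥ w₁)) i := by
    intro i y
    have h1 : star w₁ ᵥ* (p * (x i)ᴴ) = star (fun y => e y i) := by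
      rw [← hx, star_mulVec, ← vecMul_vecMul]
      congr 1
      rw [← hp.isHermitian, ← star_mulVec, hpw₁]
    rw [← mulVec_mulVec, dotProduct_mulVec, h1]
    rfl
  have hMH : ∀ {y}, y ∈ M → yᴴ ∈ M := fun hy => star_mem hy
  have hpu : ∀ i, p * (x i * p)ᴴ = (x i * p)ᴴ := by
    intro i
    rw [conjTranspose_mul, hp.isHermitian, ← Matrix.mul_assoc, hp.idem]
  refine ⟨a, fun i => x i * p, ?_, fun i => M.mul_mem (hxM i) hp.mem,
    fun i => by rw [Matrix.mul_assoc, hp.idem], ?_, ?_⟩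
  · refine Nat.pos_of_ne_zero ?_
    rintro rfl
    have := heS w₁ ⟨1, M.one_mem, by simp⟩
    have h0 : w₁ = 0 := by
      rw [← this]
      funext y
      simp [mulVec, dotProduct]
    rw [h0] at hunit
    simp at hunit
  · intro i i'
    obtain ⟨c, hc⟩ := hp.scalar _ (M.mul_mem (hMH (hxM i)) (hxM i'))
    have hc' : (x i * p)ᴴ * (x i' * p) = c • p := by
      rw [conjTranspose_mul, hp.isHermitian, ← hc]
      simp only [Matrix.mul_assoc]
    have h1 : c = (1 : Matrix (Fin a) (Fin a) ℂ) i i' := by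
      rw [← hscal c, ← hc, ← he, ← Matrix.mul_assoc, Matrix.mul_assoc, hinner, ← mulVec_mulVec,
        hpw₁, hx]
      rfl
    rw [hc', h1, one_apply]
    split_ifs <;> simp
  · intro y hy hyp
    have hcoef : ∀ i, (x i * p)ᴴ * y = ((eᴴ *ᵥ (y *ᵥ w₁)) i) • p := by
      intro i
      obtain ⟨c, hc⟩ := hp.scalar _ (M.mul_mem (hMH (hxM i)) hy)
      have hc' : (x i * p)ᴴ * y = c • p := by
        rw [conjTranspose_mul, hp.isHermitian, ← hc]
        simp only [Matrix.mul_assoc, hyp]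
      rw [hc', ← hinner, ← hp.isHermitian, ← conjTranspose_mul, hc', hscal]
    -- the difference `d` of the two sides lies in `M p` and kills `w₁`, and `dᴴ d ∈ ℂ p`
    set d := ∑ i, x i * p * ((x i * p)ᴴ * y) - y with hd
    have hdM : d ∈ M := by
      refine M.sub_mem (sum_mem fun i _ => ?_) hy
      have := M.mul_mem (hxM i) hp.mem
      exact M.mul_mem this (M.mul_mem (hMH this) hy)
    have hdp : d * p = d := by
      rw [hd, Matrix.sub_mul, hyp, Finset.sum_mul]
      simp only [Matrix.mul_assoc, hyp]
    have hdw : d *ᵥ w₁ = 0 := by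
      rw [hd, sub_mulVec, Matrix.sum_mulVec, sub_eq_zero]
      rw [← heS (y *ᵥ w₁) ⟨y, hy, rfl⟩]
      funext z
      rw [Finset.sum_apply]
      have hsum : ∀ c : Fin a → ℂ, (e *ᵥ c) z = ∑ i, e z i * c i := fun _ => rfl
      rw [hsum]
      refine Finset.sum_congr rfl fun i _ => ?_
      rw [hcoef, Matrix.mul_smul, Matrix.mul_assoc, hp.idem, smul_mulVec, ← mulVec_mulVec, hpw₁,
        hx, Pi.smul_apply, smul_eq_mul, mul_comm]
    obtain ⟨c, hc⟩ := hp.scalar _ (M.mul_mem (hMH hdM) hdM)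
    have hdd : dᴴ * d = c • p := by
      rw [← hc]
      nth_rw 1 [← hdp]
      nth_rw 2 [← hdp]
      rw [conjTranspose_mul, hp.isHermitian]
      simp only [Matrix.mul_assoc]
    have hc0 : c = 0 := by
      rw [← hscal c, ← hdd, ← mulVec_mulVec, hdw]
      simp
    rw [hc0, zero_smul] at hdd
    exact sub_eq_zero.1 (Matrix.conjTranspose_mul_self_eq_zero.1 hdd)

end IsMinimalProjection

/-- A maximal family of pairwise inequivalent minimal projections, one for each block of `M`;
`p` and `p'` are inequivalent when `p M p' = 0`. -/
theorem exists_maximal_minimalProjections (M : StarSubalgebra ℂ (Matrix m m ℂ)) :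
    ∃ (N : ℕ) (p : Fin N → Matrix m m ℂ), (∀ α, IsMinimalProjection M (p α)) ∧
      (∀ α β, α ≠ β → ∀ x ∈ M, p α * x * p β = 0) ∧
      ∀ p', IsMinimalProjection M p' → ∃ α, ∃ x ∈ M, p' * x * p α ≠ 0 := by
  classical
  let 𝒮 : Set (Set (Matrix m m ℂ)) := {F | (∀ p ∈ F, IsMinimalProjection M p) ∧
    ∀ p ∈ F, ∀ p' ∈ F, p ≠ p' → ∀ x ∈ M, p * x * p' = 0}
  obtain ⟨F, hF⟩ := zorn_subset 𝒮 (by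
    intro c hc hchain
    refine ⟨⋃₀ c, ⟨?_, ?_⟩, fun s hs => Set.subset_sUnion_of_mem hs⟩
    · rintro p ⟨s, hs, hp⟩
      exact (hc hs).1 p hp
    · rintro p ⟨s, hs, hp⟩ p' ⟨s', hs', hp'⟩ hne
      rcases hchain.total hs hs' with h | h
      · exact (hc hs').2 p (h hp) p' hp' hne
      · exact (hc hs).2 p hp p' (h hp') hne)
  have hlin : LinearIndependent ℂ (fun p : F => (p : Matrix m m ℂ)) := by
    rw [linearIndependent_iff']
    intro s g hg p hps
    have h := congrArg (fun x => x * (p : Matrix m m ℂ)) hg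
    simp only [Finset.sum_mul, Matrix.zero_mul] at h
    rw [Finset.sum_eq_single p] at h
    · rw [smul_mul_assoc, (hF.prop.1 p p.2).idem] at h
      exact (smul_eq_zero.1 h).resolve_right (hF.prop.1 p p.2).ne_zero
    · intro p' _ hne
      have := hF.prop.2 p' p'.2 p p.2 (fun h => hne (Subtype.ext h)) 1 M.one_mem
      rw [Matrix.mul_one] at this
      rw [smul_mul_assoc, this, smul_zero]
    · exact fun h => absurd hps h
  have : Finite F := hlin.finite
  have := Fintype.ofFinite F
  let e := Fintype.equivFin F
  refine ⟨Fintype.card F, fun α => e.symm α, fun α => hF.prop.1 _ (e.symm α).2, ?_, ?_⟩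
  · intro α β hne
    exact hF.prop.2 _ (e.symm α).2 _ (e.symm β).2
      fun h => hne (e.symm.injective (Subtype.ext h))
  · intro p' hp'
    by_contra! hall
    have hall' : ∀ p ∈ F, ∀ x ∈ M, p' * x * p = 0 := by
      intro p hp x hx
      simpa using hall (e ⟨p, hp⟩) x hx
    have hall'' : ∀ p ∈ F, ∀ x ∈ M, p * x * p' = 0 := by
      intro p hp x hx
      have := congrArg conjTranspose (hall' p hp _ (star_mem hx))
      simpa [Matrix.star_eq_conjTranspose, conjTranspose_mul, hp'.isHermitian,
        (hF.prop.1 p hp).isHermitian, Matrix.mul_assoc] using this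
    have hmem : insert p' F ∈ 𝒮 := by
      refine ⟨?_, ?_⟩
      · rintro p (rfl | hp)
        exacts [hp', hF.prop.1 p hp]
      · rintro p (rfl | hp) p₂ (rfl | hp₂) hne
        exacts [absurd rfl hne, hall' _ hp₂, hall'' _ hp, hF.prop.2 _ hp _ hp₂ hne]
    have hin : p' ∈ F := hF.le_of_ge hmem (Set.subset_insert _ _) (Set.mem_insert _ _)
    have := hall' p' hin 1 M.one_mem
    rw [Matrix.mul_one, hp'.idem] at this
    exact hp'.ne_zero this

end LinearAlgebra

/-! ### The spatial Wedderburn decomposition -/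

section BlockDiagonal

variable {N : ℕ} {a b : Fin N → ℕ} {l : Type*}

theorem mul_blockDiagonal'_kronecker_one
    (X : Matrix l (Σ α, Fin (a α) × Fin (b α)) ℂ)
    (O : ∀ α, Matrix (Fin (a α)) (Fin (a α)) ℂ) (x : l) (α : Fin N) (i : Fin (a α))
    (j : Fin (b α)) :
    (X * blockDiagonal' fun α => O α ⊗ₖ (1 : Matrix (Fin (b α)) (Fin (b α)) ℂ)) x ⟨α, (i, j)⟩ =
      ∑ i', X x ⟨α, (i', j)⟩ * O α i' i := by
  rw [Matrix.mul_apply, Fintype.sum_sigma, Finset.sum_eq_single α]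
  · rw [Fintype.sum_prod_type]
    refine Finset.sum_congr rfl fun i' _ => ?_
    rw [Finset.sum_eq_single j]
    · simp
    · intro j' _ hj
      simp [hj]
    · simp
  · intro β _ hβ
    refine Finset.sum_eq_zero fun y _ => ?_
    rw [blockDiagonal'_apply_ne _ _ _ hβ, mul_zero]
  · simp

end BlockDiagonal

section Wedderburn

/-- Spatial Wedderburn decomposition of a star-algebra `M` of matrices. The block `α` comes from a
minimal projection `p_α`; its basis vectors are `|α, i j⟩ = u_{α i} w_{α j}`, where the `u_{α i}`
form an orthonormal basis of the left ideal `M p_α` and the `w_{α j}` one of the range of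
`p_α`. -/
theorem exists_wedderburn {K : ℕ} (M : StarSubalgebra ℂ (Matrix (Fin K) (Fin K) ℂ)) :
    ∃ (N : ℕ) (a b : Fin N → ℕ) (B : Matrix (Fin K) (Σ α, Fin (a α) × Fin (b α)) ℂ),
      (∀ α, 0 < a α) ∧ (∀ α, 0 < b α) ∧ Bᴴ * B = 1 ∧ B * Bᴴ = 1 ∧
      ∀ T, T ∈ M ↔ ∃ O : ∀ α, Matrix (Fin (a α)) (Fin (a α)) ℂ,
        T * B = B * blockDiagonal' fun α => O α ⊗ₖ (1 : Matrix (Fin (b α)) (Fin (b α)) ℂ) := by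
  obtain ⟨N, p, hp, hpp, hmax⟩ := exists_maximal_minimalProjections M
  choose b w hb hw hwp hpw using fun α => (hp α).exists_isometry
  choose a u ha huM hup huu hus using fun α => (hp α).exists_leftIdeal_basis
  have hMH : ∀ {y}, y ∈ M → yᴴ ∈ M := fun hy => star_mem hy
  have hpuH : ∀ α i, p α * (u α i)ᴴ = (u α i)ᴴ := by
    intro α i
    rw [← (hp α).isHermitian, ← conjTranspose_mul, hup]
  have horth : ∀ α β, α ≠ β → ∀ i i', (u α i)ᴴ * u β i' = 0 := by
    intro α β hne i i'
    rw [← hpuH, ← hup β, Matrix.mul_assoc, ← Matrix.mul_assoc _ _ (p β), ← Matrix.mul_assoc]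
    exact hpp α β hne _ (M.mul_mem (hMH (huM α i)) (huM β i'))
  let B : Matrix (Fin K) (Σ α, Fin (a α) × Fin (b α)) ℂ :=
    Matrix.of fun x y => (u y.1 y.2.1 * w y.1) x y.2.2
  have hBB : B * Bᴴ = ∑ α, ∑ i, u α i * (u α i)ᴴ := by
    have : ∀ α i, u α i * (u α i)ᴴ = (u α i * w α) * (u α i * w α)ᴴ := by
      intro α i
      rw [conjTranspose_mul, Matrix.mul_assoc, ← Matrix.mul_assoc (w α), hwp, hpuH]
    simp only [this]
    ext x y
    rw [Matrix.mul_apply, Fintype.sum_sigma, Matrix.sum_apply]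
    refine Finset.sum_congr rfl fun α _ => ?_
    rw [Fintype.sum_prod_type, Matrix.sum_apply]
    rfl
  set P := ∑ α, ∑ i, u α i * (u α i)ᴴ with hP
  have hPM : P ∈ M := sum_mem fun α _ => sum_mem fun i _ => M.mul_mem (huM α i) (hMH (huM α i))
  have hPu : ∀ α i, P * u α i = u α i := by
    intro α i
    rw [hP, Finset.sum_mul, Finset.sum_eq_single α]
    · rw [Finset.sum_mul]
      simp only [Matrix.mul_assoc]
      exact hus α _ (huM α i) (hup α i)
    · intro β _ hne
      rw [Finset.sum_mul]
      simp [Matrix.mul_assoc, horth β α hne]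
    · simp
  clear_value P
  have hPP : P * P = P := by
    conv_lhs => rhs; rw [hP]
    simp only [Finset.mul_sum, ← Matrix.mul_assoc, hPu]
    exact hP.symm
  -- otherwise a minimal projection below `1 - P` would be inequivalent to all the `p α`
  have hP1 : P = 1 := by
    by_contra hne
    obtain ⟨p', hp', hQp'⟩ := exists_minimalProjection M (M.sub_mem M.one_mem hPM)
      (sub_ne_zero.2 (Ne.symm hne))
      (by rw [Matrix.sub_mul, Matrix.mul_sub, Matrix.mul_sub, hPP]; simp)
    obtain ⟨α, x, hx, hne⟩ := hmax p' hp'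
    apply hne
    have hp'u : ∀ i, (u α i)ᴴ * p' = 0 := by
      intro i
      rw [← hQp', ← Matrix.mul_assoc]
      have : (u α i)ᴴ * (1 - P) = 0 := by
        have hPH : Pᴴ = P := by simp [hP, conjTranspose_sum]
        have := congrArg conjTranspose (hPu α i)
        rw [conjTranspose_mul, hPH] at this
        rw [Matrix.mul_sub, this, Matrix.mul_one, sub_self]
      rw [this, Matrix.zero_mul]
    rw [← hus α (p' * x * p α) (M.mul_mem (M.mul_mem hp'.mem hx) (hp α).mem)
      (by rw [Matrix.mul_assoc, (hp α).idem])]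
    refine Finset.sum_eq_zero fun i _ => ?_
    rw [Matrix.mul_assoc p', ← Matrix.mul_assoc _ p', hp'u]
    simp
  have hBblk : ∀ (T : Matrix (Fin K) (Fin K) ℂ) (O : ∀ α, Matrix (Fin (a α)) (Fin (a α)) ℂ),
      (T * B = B * blockDiagonal' fun α => O α ⊗ₖ (1 : Matrix (Fin (b α)) (Fin (b α)) ℂ)) ↔
        ∀ α i, T * (u α i * w α) = ∑ i', O α i' i • (u α i' * w α) := by
    intro T O
    constructor
    · intro h α i
      ext x j
      have := congrFun (congrFun h x) ⟨α, (i, j)⟩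
      rw [mul_blockDiagonal'_kronecker_one] at this
      rw [Matrix.sum_apply]
      refine this.trans (Finset.sum_congr rfl fun i' _ => ?_)
      exact mul_comm _ _
    · intro h
      ext x ⟨α, i, j⟩
      rw [mul_blockDiagonal'_kronecker_one]
      have := congrFun (congrFun (h α i) x) j
      rw [Matrix.sum_apply] at this
      refine this.trans (Finset.sum_congr rfl fun i' _ => ?_)
      exact mul_comm _ _
  refine ⟨N, a, b, B, ha, hb, ?_, hBB.trans hP1, fun T => ⟨fun hT => ?_, ?_⟩⟩
  · ext ⟨α, i, j⟩ ⟨β, i', j'⟩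
    have h1 : (Bᴴ * B) ⟨α, i, j⟩ ⟨β, i', j'⟩ = ((u α i * w α)ᴴ * (u β i' * w β)) j j' := rfl
    rw [h1, conjTranspose_mul, Matrix.mul_assoc, ← Matrix.mul_assoc (u α i)ᴴ]
    by_cases hαβ : α = β
    · subst hαβ
      rw [huu]
      by_cases hi : i = i'
      · subst hi
        rw [if_pos rfl, hpw, hw]
        simp [Matrix.one_apply]
      · simp [hi]
    · rw [horth α β hαβ]
      simp [hαβ]
  · have : ∀ α i i', ∃ c : ℂ, (u α i')ᴴ * (T * u α i) = c • p α := by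
      intro α i i'
      obtain ⟨c, hc⟩ := (hp α).scalar _ (M.mul_mem (hMH (huM α i')) (M.mul_mem hT (huM α i)))
      refine ⟨c, ?_⟩
      rw [← hc, ← Matrix.mul_assoc (p α), hpuH]
      simp only [Matrix.mul_assoc, hup]
    choose c hc using this
    refine ⟨fun α => Matrix.of fun i' i => c α i i', (hBblk _ _).2 fun α i => ?_⟩
    rw [← Matrix.mul_assoc, ← hus α (T * u α i) (M.mul_mem hT (huM α i))
      (by rw [Matrix.mul_assoc, hup]), Matrix.sum_mul]
    refine Finset.sum_congr rfl fun i' _ => ?_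
    rw [hc, Matrix.mul_smul, hup, Matrix.smul_mul, Matrix.of_apply]
  · rintro ⟨O, hO⟩
    rw [hBblk] at hO
    rw [← Matrix.mul_one T, ← hP1, hP, Finset.mul_sum]
    refine sum_mem fun α _ => ?_
    rw [Finset.mul_sum]
    refine sum_mem fun i _ => ?_
    have : T * (u α i * (u α i)ᴴ) = ∑ i', O α i' i • (u α i' * (u α i)ᴴ) := by
      have := congrArg (fun z => z * ((w α)ᴴ * (u α i)ᴴ)) (hO α i)
      simp only [Matrix.sum_mul, Matrix.smul_mul] at this
      have hh : ∀ i', u α i' * w α * ((w α)ᴴ * (u α i)ᴴ) = u α i' * (u α i)ᴴ := by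
        intro i'
        rw [Matrix.mul_assoc, ← Matrix.mul_assoc (w α), hwp, hpuH]
      simp only [hh] at this
      rw [← this, Matrix.mul_assoc, hh]
    rw [this]
    exact sum_mem fun i' _ => M.smul_mem (M.mul_mem (huM α i') (hMH (huM α i))) _

end Wedderburn

/-! ### Von Neumann entropy -/

section Entropy

open Polynomial

variable {m k : Type} [Fintype m] [DecidableEq m] [Fintype k] [DecidableEq k]

theorem roots_charpoly_diagonal_ofReal (d : k → ℝ) :
    (diagonal (fun i => (d i : ℂ))).charpoly.roots =
      (Finset.univ.val.map d).map (fun r : ℝ => (r : ℂ)) := by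
  rw [charpoly_diagonal, roots_prod _ _ (by
    rw [Finset.prod_ne_zero_iff]; intro i _; exact X_sub_C_ne_zero _)]
  simp [Multiset.bind_singleton]

/-- Multisets of reals that agree up to zeros have equal sums of `f` when `f 0 = 0`. -/
theorem sum_map_eq_of_map_ofReal_add {f : ℝ → ℝ} (h0 : f 0 = 0) {s t : Multiset ℝ} {a b : ℕ}
    (h : Multiset.replicate a (0 : ℂ) + s.map (fun r : ℝ => (r : ℂ)) =
      Multiset.replicate b (0 : ℂ) + t.map (fun r : ℝ => (r : ℂ))) :
    (s.map f).sum = (t.map f).sum := by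
  have h2 := congrArg (fun u : Multiset ℂ => (u.map fun z => f z.re).sum) h
  simpa [Multiset.map_map, h0] using h2

/-- The entropy of an isometrically embedded diagonal state. `U D Uᴴ` and `D` have the same
eigenvalues up to zeros, which contribute nothing. -/
theorem entropy_eq_of_isometry (U : Matrix m k ℂ) (hU : Uᴴ * U = 1) (d : k → ℝ) :
    entropy (U * diagonal (fun i => (d i : ℂ)) * Uᴴ) = ∑ i, Real.negMulLog (d i) := by
  set D : Matrix k k ℂ := diagonal (fun i => (d i : ℂ)) with hD
  have hH : (U * D * Uᴴ).IsHermitian := by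
    have hDH : Dᴴ = D := by
      rw [hD, diagonal_conjTranspose]
      congr 1
      funext i
      simp
    rw [Matrix.IsHermitian, conjTranspose_mul, conjTranspose_mul, conjTranspose_conjTranspose, hDH,
      Matrix.mul_assoc]
  have hroots : D.charpoly.roots = _ := roots_charpoly_diagonal_ofReal d
  rw [entropy, dif_pos hH]
  have h1 := charpoly_mul_comm' (U * D) Uᴴ
  rw [← Matrix.mul_assoc, hU, Matrix.one_mul] at h1
  have h2 := congrArg roots h1
  rw [roots_mul (mul_ne_zero (pow_ne_zero _ X_ne_zero) (charpoly_monic _).ne_zero),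
    roots_mul (mul_ne_zero (pow_ne_zero _ X_ne_zero) (charpoly_monic _).ne_zero),
    roots_X_pow, roots_X_pow, hH.roots_charpoly_eq_eigenvalues, hroots,
    Multiset.nsmul_singleton, Multiset.nsmul_singleton] at h2
  have h3 := sum_map_eq_of_map_ofReal_add (f := Real.negMulLog) Real.negMulLog_zero
    (s := Finset.univ.val.map hH.eigenvalues) (t := Finset.univ.val.map d)
    (by simpa [Multiset.map_map] using h2)
  simpa [Multiset.map_map] using h3

theorem exists_diagonalization {M : Matrix m m ℂ} (hM : M.IsHermitian) :
    ∃ (W : Matrix m m ℂ) (d : m → ℝ), Wᴴ * W = 1 ∧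
      M = W * diagonal (fun i => (d i : ℂ)) * Wᴴ := by
  refine ⟨hM.eigenvectorUnitary, hM.eigenvalues, ?_, ?_⟩
  · exact mem_unitaryGroup_iff'.1 hM.eigenvectorUnitary.2
  · conv_lhs => rw [hM.spectral_theorem]
    rfl

variable {N : ℕ} {a s : Fin N → ℕ}

/-- Entropy of the block-diagonal state `⨁_α ρ_α ⊗ χ_α`, isometrically embedded. -/
theorem entropy_blockDiagonal'_kronecker
    (U : Matrix m (Σ α, Fin (a α) × Fin (s α)) ℂ) (hU : Uᴴ * U = 1)
    (ρ : ∀ α, Matrix (Fin (a α)) (Fin (a α)) ℂ) (χ : ∀ α, Matrix (Fin (s α)) (Fin (s α)) ℂ)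
    (hρ : ∀ α, (ρ α).IsHermitian) (hχ : ∀ α, (χ α).IsHermitian) (hχ1 : ∀ α, (χ α).trace = 1) :
    entropy (U * blockDiagonal' (fun α => ρ α ⊗ₖ χ α) * Uᴴ) =
      ∑ α, (entropy (ρ α) + (ρ α).trace.re * entropy (χ α)) := by
  choose W d hW hd using fun α => exists_diagonalization (hρ α)
  choose X e hX he using fun α => exists_diagonalization (hχ α)
  have htr : ∀ {n : ℕ} (W : Matrix (Fin n) (Fin n) ℂ) (d : Fin n → ℝ), Wᴴ * W = 1 →
      (W * diagonal (fun i => (d i : ℂ)) * Wᴴ).trace = ((∑ i, d i : ℝ) : ℂ) := by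
    intro n W d hW
    rw [Matrix.trace_mul_comm, ← Matrix.mul_assoc, hW, Matrix.one_mul, trace_diagonal]
    push_cast
    rfl
  set Y : Matrix (Σ α, Fin (a α) × Fin (s α)) (Σ α, Fin (a α) × Fin (s α)) ℂ :=
    blockDiagonal' (fun α => W α ⊗ₖ X α) with hY
  have hYY : Yᴴ * Y = 1 := by
    rw [hY, blockDiagonal'_conjTranspose, ← blockDiagonal'_mul]
    simp only [conjTranspose_kronecker, ← mul_kronecker_mul, hW, hX, one_kronecker_one]
    exact blockDiagonal'_one
  have hdiag : blockDiagonal' (fun α => ρ α ⊗ₖ χ α) =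
      Y * diagonal (fun x : Σ α, Fin (a α) × Fin (s α) =>
        ((d x.1 x.2.1 * e x.1 x.2.2 : ℝ) : ℂ)) * Yᴴ := by
    have : diagonal (fun x : Σ α, Fin (a α) × Fin (s α) =>
        ((d x.1 x.2.1 * e x.1 x.2.2 : ℝ) : ℂ)) = blockDiagonal' (fun α =>
          diagonal (fun i => (d α i : ℂ)) ⊗ₖ diagonal (fun i => (e α i : ℂ))) := by
      simp only [diagonal_kronecker_diagonal, blockDiagonal'_diagonal]
      simp
    rw [this, hY, blockDiagonal'_conjTranspose, ← blockDiagonal'_mul, ← blockDiagonal'_mul]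
    simp only [conjTranspose_kronecker, ← mul_kronecker_mul, ← hd, ← he]
  have hUY : (U * Y)ᴴ * (U * Y) = 1 := by
    rw [conjTranspose_mul, Matrix.mul_assoc, ← Matrix.mul_assoc Uᴴ, hU, Matrix.one_mul, hYY]
  have hM : U * blockDiagonal' (fun α => ρ α ⊗ₖ χ α) * Uᴴ =
      (U * Y) * diagonal (fun x : Σ α, Fin (a α) × Fin (s α) =>
        ((d x.1 x.2.1 * e x.1 x.2.2 : ℝ) : ℂ)) * (U * Y)ᴴ := by
    rw [hdiag, conjTranspose_mul]
    simp only [Matrix.mul_assoc]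
  rw [hM, entropy_eq_of_isometry _ hUY, Fintype.sum_sigma]
  refine Finset.sum_congr rfl fun α _ => ?_
  have he1 : ∑ t, e α t = 1 := by
    have := hχ1 α
    rw [he α, htr _ _ (hX α)] at this
    exact_mod_cast this
  have htrρ : (ρ α).trace.re = ∑ i, d α i := by
    rw [hd α, htr _ _ (hW α), Complex.ofReal_re]
  have hSρ : entropy (ρ α) = ∑ i, Real.negMulLog (d α i) := by
    rw [hd α, entropy_eq_of_isometry _ (hW α)]
  have hSχ : entropy (χ α) = ∑ i, Real.negMulLog (e α i) := by
    rw [he α, entropy_eq_of_isometry _ (hX α)]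
  rw [Fintype.sum_prod_type, htrρ, hSρ, hSχ]
  simp only [Real.negMulLog_mul, Finset.sum_add_distrib, ← Finset.sum_mul, ← Finset.mul_sum, he1,
    one_mul]

/-- A state with flat spectrum, all its nonzero eigenvalues being `t`, has entropy `-log t`. -/
theorem entropy_of_sq_eq_smul {M : Matrix m m ℂ} (hM : M.IsHermitian) {t : ℝ}
    (hsq : M * M = (t : ℂ) • M) (htr : M.trace = 1) : entropy M = -Real.log t := by
  obtain ⟨W, d, hW, hd⟩ := exists_diagonalization hM
  have hD : diagonal (fun i => (d i : ℂ)) = Wᴴ * M * W := by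
    rw [hd]
    simp only [Matrix.mul_assoc, hW, Matrix.mul_one]
    rw [← Matrix.mul_assoc, hW, Matrix.one_mul]
  have hWW : W * Wᴴ = 1 := mul_eq_one_comm.1 hW
  have hDD : diagonal (fun i => (d i : ℂ)) * diagonal (fun i => (d i : ℂ)) =
      (t : ℂ) • diagonal (fun i => (d i : ℂ)) := by
    rw [hD, ← Matrix.smul_mul, ← Matrix.mul_smul, ← hsq]
    simp only [Matrix.mul_assoc]
    rw [← Matrix.mul_assoc W, hWW, Matrix.one_mul]
  have hdd : ∀ i, d i * d i = t * d i := by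
    intro i
    have := congrFun (congrFun hDD i) i
    rw [diagonal_mul_diagonal, Matrix.smul_apply, diagonal_apply_eq,
      diagonal_apply_eq, smul_eq_mul] at this
    exact_mod_cast this
  have hsum : ∑ i, d i = 1 := by
    have h := htr
    rw [hd, Matrix.trace_mul_comm, ← Matrix.mul_assoc, hW, Matrix.one_mul, trace_diagonal] at h
    exact_mod_cast h
  have hlog : ∀ i, Real.negMulLog (d i) = d i * -Real.log t := by
    intro i
    rcases eq_or_ne (d i) 0 with h | h
    · simp [h]
    · rw [Real.negMulLog, mul_right_cancel₀ h (hdd i)]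
      ring
  rw [hd, entropy_eq_of_isometry _ hW]
  simp only [hlog, ← Finset.sum_mul, hsum, one_mul]

end Entropy

/-! ### Weyl operators -/

section Weyl

variable {q : ℕ} [NeZero q] {ι : Type} [Fintype ι]

/-- The bicharacter `exp(2πi ⟨b, y⟩ / q)` of `(ℤ/q)^ι`. -/
noncomputable def bichar (b y : Config q ι) : ℂ := ∏ i, ZMod.stdAddChar (b i * y i)

theorem bichar_add_right (b y z : Config q ι) :
    bichar b (y + z) = bichar b y * bichar b z := by
  simp only [bichar, Pi.add_apply, mul_add, AddChar.map_add_eq_mul, Finset.prod_mul_distrib]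

theorem bichar_add_left (b c y : Config q ι) : bichar (b + c) y = bichar b y * bichar c y := by
  simp only [bichar, Pi.add_apply, add_mul, AddChar.map_add_eq_mul, Finset.prod_mul_distrib]

theorem conj_bichar_mul_self (b y : Config q ι) : conj (bichar b y) * bichar b y = 1 := by
  simp only [bichar, map_prod, ← Finset.prod_mul_distrib]
  refine Finset.prod_eq_one fun i _ => ?_
  rw [ZMod.stdAddChar_apply, ← Circle.coe_inv_eq_conj, ← Circle.coe_mul, inv_mul_cancel,
    Circle.coe_one]

theorem bichar_ne_zero (b y : Config q ι) : bichar b y ≠ 0 := fun h => by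
  have := conj_bichar_mul_self b y
  simp [h] at this

variable [DecidableEq ι]

theorem sum_bichar_mul_conj (y z : Config q ι) :
    ∑ b, bichar b y * conj (bichar b z) = if y = z then (q : ℂ) ^ Fintype.card ι else 0 := by
  have h1 : ∀ b : Config q ι, bichar b y * conj (bichar b z) =
      ∏ i, ZMod.stdAddChar (b i * (y i - z i)) := by
    intro b
    simp only [bichar, map_prod, ← Finset.prod_mul_distrib]
    refine Finset.prod_congr rfl fun i _ => ?_
    rw [mul_sub, AddChar.map_sub_eq_div, ZMod.stdAddChar_apply (b i * z i),
      ← Circle.coe_inv_eq_conj, Circle.coe_inv, div_eq_mul_inv]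
  simp only [h1]
  rw [← Fintype.prod_sum fun i (t : ZMod q) => (ZMod.stdAddChar (t * (y i - z i)) : ℂ)]
  simp only [AddChar.sum_mulShift _ (ZMod.isPrimitive_stdAddChar q), sub_eq_zero]
  split_ifs with h
  · subst h
    simp [ZMod.card]
  · obtain ⟨i, hi⟩ := Function.ne_iff.1 h
    exact Finset.prod_eq_zero (Finset.mem_univ i) (by simp [hi])

/-- The Weyl operator `X^a Z^b`, i.e. `|y⟩ ↦ exp(2πi ⟨b, y⟩ / q) |y + a⟩`. -/
noncomputable def weyl (l : Config q ι × Config q ι) : Op q ι :=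
  Matrix.of fun x y => if x = y + l.1 then bichar l.2 y else 0

theorem weyl_apply (l : Config q ι × Config q ι) (x y : Config q ι) :
    weyl l x y = if x = y + l.1 then bichar l.2 y else 0 := rfl

/-- Orthogonality and completeness of the Weyl operators, in matrix entries. -/
theorem sum_weyl_mul_conj (x y x' y' : Config q ι) :
    ∑ l : Config q ι × Config q ι, weyl l x y * conj (weyl l x' y') =
      if x = x' ∧ y = y' then (q : ℂ) ^ Fintype.card ι else 0 := by
  rw [Fintype.sum_prod_type, Finset.sum_eq_single (x - y)]
  · simp only [weyl_apply, add_sub_cancel, if_true]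
    by_cases h : x' = y' + (x - y)
    · simp only [h, if_true, sum_bichar_mul_conj]
      refine if_congr ?_ rfl rfl
      constructor
      · rintro rfl; simp
      · rintro ⟨_, rfl⟩; rfl
    · rw [if_neg]
      · simp [h]
      · rintro ⟨rfl, rfl⟩
        simp at h
  · intro a _ ha
    refine Finset.sum_eq_zero fun b _ => ?_
    rw [weyl_apply, if_neg, zero_mul]
    rintro rfl
    simp at ha
  · simp

theorem weyl_mul_weyl (k l : Config q ι × Config q ι) :
    weyl k * weyl l = bichar k.2 l.1 • weyl (k + l) := by
  ext x y
  rw [Matrix.mul_apply, Finset.sum_eq_single (y + l.1)]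
  · simp only [Matrix.smul_apply, weyl_apply, if_true, Prod.fst_add, Prod.snd_add, smul_eq_mul]
    have : x = y + l.1 + k.1 ↔ x = y + (k.1 + l.1) := by rw [add_assoc, add_comm l.1]
    simp only [this]
    split_ifs
    · rw [bichar_add_right, bichar_add_left]
      ring
    · simp
  · intro z _ hz
    rw [weyl_apply l, if_neg hz, mul_zero]
  · simp

theorem weyl_mul_weyl_comm (k l : Config q ι × Config q ι) :
    weyl k * weyl l = (bichar k.2 l.1 * (bichar l.2 k.1)⁻¹) • (weyl l * weyl k) := by
  rw [weyl_mul_weyl, weyl_mul_weyl, smul_smul, mul_assoc, inv_mul_cancel₀ (bichar_ne_zero _ _),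
    mul_one, add_comm]

theorem conjTranspose_weyl_mul_self (l : Config q ι × Config q ι) : (weyl l)ᴴ * weyl l = 1 := by
  ext x y
  rw [Matrix.mul_apply, Finset.sum_eq_single (x + l.1)]
  · rw [conjTranspose_apply, weyl_apply, if_pos rfl, weyl_apply]
    by_cases h : x = y
    · subst h
      simpa using conj_bichar_mul_self l.2 x
    · rw [if_neg (by simpa using h), mul_zero, one_apply_ne h]
  · intro z _ hz
    rw [conjTranspose_apply, weyl_apply, if_neg hz, star_zero, zero_mul]
  · simp

theorem weyl_mul_conjTranspose_self (l : Config q ι × Config q ι) : weyl l * (weyl l)ᴴ = 1 :=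
  mul_eq_one_comm.1 (conjTranspose_weyl_mul_self l)

/-- Expansion of an arbitrary operator in Weyl operators. -/
theorem sum_trace_smul_weyl (Y : Op q ι) :
    ∑ l : Config q ι × Config q ι, ((weyl l)ᴴ * Y).trace • weyl l =
      (q : ℂ) ^ Fintype.card ι • Y := by
  ext x y
  simp only [Matrix.sum_apply, Matrix.smul_apply, smul_eq_mul, Matrix.trace, Matrix.diag,
    Matrix.mul_apply, conjTranspose_apply, Finset.sum_mul]
  rw [Finset.sum_comm]
  calc _ = ∑ v, ∑ u, (∑ l : Config q ι × Config q ι, weyl l x y * conj (weyl l u v)) * Y u v := by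
        refine Finset.sum_congr rfl fun v _ => ?_
        rw [Finset.sum_comm]
        refine Finset.sum_congr rfl fun u _ => ?_
        rw [Finset.sum_mul]
        refine Finset.sum_congr rfl fun l _ => ?_
        rw [Complex.star_def]
        ring
    _ = _ := by
        simp only [sum_weyl_mul_conj]
        rw [Finset.sum_eq_single y, Finset.sum_eq_single x]
        · simp
        · intro u _ hu
          rw [if_neg (fun h => hu h.1.symm), zero_mul]
        · simp
        · intro v _ hv
          refine Finset.sum_eq_zero fun u _ => ?_
          rw [if_neg (fun h => hv h.2.symm), zero_mul]
        · simp

/-- Twirling over the Weyl operators of the first factor replaces `X` by a multiple of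
`1 ⊗ Tr₁ X`. -/
theorem sum_weyl_kronecker_conj {κ : Type*} [Fintype κ] [DecidableEq κ]
    (X : Matrix (Config q ι × κ) (Config q ι × κ) ℂ) :
    ∑ l : Config q ι × Config q ι, (weyl l ⊗ₖ (1 : Matrix κ κ ℂ)) * X *
        (weyl l ⊗ₖ (1 : Matrix κ κ ℂ))ᴴ =
      (1 : Op q ι) ⊗ₖ Matrix.of fun s s' =>
        (q : ℂ) ^ Fintype.card ι * ∑ z, X (z, s) (z, s') := by
  have hl : ∀ (W : Op q ι) (Y : Matrix (Config q ι × κ) (Config q ι × κ) ℂ) x s y,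
      ((W ⊗ₖ (1 : Matrix κ κ ℂ)) * Y) (x, s) y = ∑ z, W x z * Y (z, s) y := by
    intro W Y x s y
    rw [Matrix.mul_apply, Fintype.sum_prod_type]
    refine Finset.sum_congr rfl fun z _ => ?_
    rw [Finset.sum_eq_single s]
    · simp
    · intro t _ ht
      simp [Matrix.one_apply_ne ht.symm]
    · simp
  have hr : ∀ (W : Op q ι) (Y : Matrix (Config q ι × κ) (Config q ι × κ) ℂ) x s y,
      (Y * (W ⊗ₖ (1 : Matrix κ κ ℂ))ᴴ) y (x, s) = ∑ z, Y y (z, s) * conj (W x z) := by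
    intro W Y x s y
    have := congrArg star (hl W Yᴴ x s y)
    rw [← Matrix.conjTranspose_apply, conjTranspose_mul, conjTranspose_conjTranspose] at this
    rw [this, star_sum]
    refine Finset.sum_congr rfl fun z _ => ?_
    rw [star_mul', conjTranspose_apply, star_star, mul_comm]
    rfl
  ext ⟨x, s⟩ ⟨x', s'⟩
  rw [Matrix.sum_apply]
  simp only [hr, hl, Finset.sum_mul]
  calc _ = ∑ z', ∑ z, (∑ l : Config q ι × Config q ι, weyl l x z * conj (weyl l x' z')) *
        X (z, s) (z', s') := by
        rw [Finset.sum_comm]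
        refine Finset.sum_congr rfl fun z' _ => ?_
        rw [Finset.sum_comm]
        refine Finset.sum_congr rfl fun z _ => ?_
        rw [Finset.sum_mul]
        refine Finset.sum_congr rfl fun l _ => ?_
        ring
    _ = _ := by
        simp only [sum_weyl_mul_conj]
        rw [kroneckerMap_apply, Matrix.of_apply]
        by_cases hx : x = x'
        · subst hx
          simp [Finset.mul_sum]
        · simp [hx]

end Weyl

/-! ### Weyl operators and the Pauli group -/

section Pauli

variable {q n : ℕ} [NeZero q]

/-- `U` and `W` commute up to a nonzero scalar. -/
def QuasiCommute {m : Type*} [Fintype m] (U W : Matrix m m ℂ) : Prop :=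
  ∃ z : ℂ, z ≠ 0 ∧ U * W = z • (W * U)

theorem shiftX_eq_weyl (i : Fin n) : shiftX q n i = weyl (Pi.single i 1, 0) := by
  ext x y
  simp [shiftX, weyl_apply, bichar]

theorem clockZ_eq_weyl (i : Fin n) : clockZ q n i = weyl (0, Pi.single i 1) := by
  ext x y
  have h : bichar (Pi.single i 1 : Config q (Fin n)) y = rootOfUnity q ^ (y i).val := by
    rw [bichar, Finset.prod_eq_single i]
    · rw [Pi.single_eq_same, one_mul, ZMod.stdAddChar_apply, ZMod.toCircle_apply, rootOfUnity,
        ← Complex.exp_nat_mul]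
      congr 1
      ring
    · intro j _ hj
      rw [Pi.single_eq_of_ne hj, zero_mul, AddChar.map_zero_eq_one]
    · simp
  rw [clockZ, weyl_apply, diagonal_apply]
  by_cases hxy : x = y
  · subst hxy
    simp [h]
  · simp [hxy]

theorem quasiCommute_weyl_of_mem_pauliGroup {U : Matrix.unitaryGroup (Config q (Fin n)) ℂ}
    (hU : U ∈ pauliGroup q n) (l : Config q (Fin n) × Config q (Fin n)) :
    QuasiCommute (U : Op q (Fin n)) (weyl l) := by
  have hW : ∀ k l : Config q (Fin n) × Config q (Fin n), QuasiCommute (weyl k) (weyl l) :=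
    fun k l => ⟨_, mul_ne_zero (bichar_ne_zero _ _) (inv_ne_zero (bichar_ne_zero _ _)),
      weyl_mul_weyl_comm k l⟩
  induction hU using Subgroup.closure_induction with
  | mem x hx =>
    rcases hx with (rfl | ⟨i, rfl⟩) | ⟨i, rfl⟩
    · exact ⟨1, one_ne_zero, by simp⟩
    · simpa only [shiftX_eq_weyl] using hW _ l
    · simpa only [clockZ_eq_weyl] using hW _ l
  | one => exact ⟨1, one_ne_zero, by simp⟩
  | mul x y _ _ hx hy =>
    obtain ⟨z, hz, h⟩ := hx
    obtain ⟨z', hz', h'⟩ := hy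
    refine ⟨z * z', mul_ne_zero hz hz', ?_⟩
    rw [Submonoid.coe_mul, Matrix.mul_assoc, h', Matrix.mul_smul, ← Matrix.mul_assoc, h,
      Matrix.smul_mul, smul_smul, Matrix.mul_assoc, mul_comm]
  | inv x _ hx =>
    obtain ⟨z, hz, h⟩ := hx
    refine ⟨z⁻¹, inv_ne_zero hz, ?_⟩
    have h1 : ((x⁻¹ : Matrix.unitaryGroup (Config q (Fin n)) ℂ) : Op q (Fin n)) *
        (x : Op q (Fin n)) = 1 := by
      rw [← Submonoid.coe_mul, inv_mul_cancel, Submonoid.coe_one]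
    set y := ((x⁻¹ : Matrix.unitaryGroup (Config q (Fin n)) ℂ) : Op q (Fin n))
    have h2 : (x : Op q (Fin n)) * y = 1 := mul_eq_one_comm.1 h1
    have h3 : weyl l * y = z • (y * weyl l) := by
      have := congrArg (fun t => y * t * y) h
      simp only [Matrix.mul_smul, Matrix.smul_mul] at this
      rw [← Matrix.mul_assoc, h1, Matrix.one_mul] at this
      rw [this, ← Matrix.mul_assoc, Matrix.mul_assoc, h2, Matrix.mul_one]
    rw [h3, smul_smul, inv_mul_cancel₀ hz, one_smul]

end Pauli

/-! ### Local operators across the bipartition -/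

section Split

variable {q n : ℕ} [NeZero q] (A : Finset (Fin n))

theorem localOp_apply (O : Op q A) (x y : Config q (Fin n)) :
    localOp A O x y = if (split q A x).2 = (split q A y).2 then
      O (split q A x).1 (split q A y).1 else 0 := by
  rw [localOp, submatrix_apply, kroneckerMap_apply, one_apply]
  split_ifs <;> simp

theorem localOp_compl (O : Op q (Aᶜ : Finset (Fin n))) :
    localOp Aᶜ O = ((1 : Op q A) ⊗ₖ O).submatrix (split q A) (split q A) := by
  ext x y
  rw [localOp_apply, submatrix_apply, kroneckerMap_apply, one_apply]
  have h : (split q Aᶜ x).2 = (split q Aᶜ y).2 ↔ (split q A x).1 = (split q A y).1 := by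
    simp only [split, Equiv.coe_fn_mk, funext_iff, Finset.restrict, Subtype.forall,
      Finset.mem_compl, not_not]
  simp only [h]
  split_ifs
  · rw [one_mul]; rfl
  · rw [zero_mul]

theorem localOp_commute (O : Op q A) (O' : Op q (Aᶜ : Finset (Fin n))) :
    localOp A O * localOp Aᶜ O' = localOp Aᶜ O' * localOp A O := by
  rw [localOp_compl, localOp, submatrix_mul_equiv, submatrix_mul_equiv, ← mul_kronecker_mul,
    ← mul_kronecker_mul]
  simp

/-- Extension by zero of the label of a Weyl operator on `A` to all qudits. -/
def extendLabel (l : Config q A × Config q A) : Config q (Fin n) × Config q (Fin n) :=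
  ((split q A).symm (l.1, 0), (split q A).symm (l.2, 0))

theorem localOp_weyl (l : Config q A × Config q A) :
    localOp A (weyl l) = weyl (extendLabel A l) := by
  ext x y
  obtain ⟨⟨x₁, x₂⟩, rfl⟩ := (split q A).symm.surjective x
  obtain ⟨⟨y₁, y₂⟩, rfl⟩ := (split q A).symm.surjective y
  have hb : bichar ((split q A).symm (l.2, 0)) ((split q A).symm (y₁, y₂)) = bichar l.2 y₁ := by
    rw [bichar, bichar, ← Finset.prod_mul_prod_compl A, ← Finset.prod_coe_sort A,
      ← Finset.prod_coe_sort Aᶜ]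
    have h2 : ∏ i : (Aᶜ : Finset (Fin n)), (ZMod.stdAddChar ((split q A).symm (l.2, 0) i *
        (split q A).symm (y₁, y₂) i) : ℂ) = 1 := by
      refine Finset.prod_eq_one fun i _ => ?_
      have : (i : Fin n) ∉ A := Finset.mem_compl.1 i.2
      simp [split, this]
    rw [h2, mul_one]
    refine Finset.prod_congr rfl fun i _ => ?_
    simp [split]
  have hadd : (split q A).symm (y₁, y₂) + (split q A).symm (l.1, 0) =
      (split q A).symm (y₁ + l.1, y₂) := by
    funext i
    by_cases hi : i ∈ A <;> simp [split, hi]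
  rw [localOp_apply, weyl_apply, weyl_apply]
  simp only [extendLabel, hb, hadd, Equiv.apply_symm_apply, EmbeddingLike.apply_eq_iff_eq,
    Prod.mk.injEq]
  by_cases h1 : x₁ = y₁ + l.1 <;> by_cases h2 : x₂ = y₂ <;> simp [h1, h2]

/-- Twirling over the Weyl operators on `A` leaves an operator on `Ā`. -/
theorem sum_localOp_weyl_conj (X : Op q (Fin n)) :
    ∃ O : Op q (Aᶜ : Finset (Fin n)),
      ∑ l, localOp A (weyl l) * X * (localOp A (weyl l))ᴴ = localOp Aᶜ O := by
  have h := sum_weyl_kronecker_conj (κ := Config q (Aᶜ : Finset (Fin n)))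
    (X.submatrix (split q A).symm (split q A).symm)
  refine ⟨Matrix.of fun s s' => (q : ℂ) ^ Fintype.card A *
    ∑ z, (X.submatrix (split q A).symm (split q A).symm) (z, s) (z, s'), ?_⟩
  rw [localOp_compl, ← h]
  have hX : X = (X.submatrix (split q A).symm (split q A).symm).submatrix (split q A)
      (split q A) := by
    simp
  conv_lhs => rw [hX]
  simp only [localOp, conjTranspose_submatrix, submatrix_mul_equiv]
  ext x y
  simp only [Matrix.sum_apply, submatrix_apply]

/-- Twirling over the Weyl operators on `Ā` computes the reduced operator on `A`. -/
theorem sum_localOp_compl_weyl_conj (X : Op q (Fin n)) :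
    ∑ l, localOp Aᶜ (weyl l) * X * (localOp Aᶜ (weyl l))ᴴ =
      localOp A ((q : ℂ) ^ Fintype.card (Aᶜ : Finset (Fin n)) • partialTrace A X) := by
  let e := (split q A).trans (Equiv.prodComm _ _)
  have h := sum_weyl_kronecker_conj (κ := Config q A) (X.submatrix e.symm e.symm)
  have hA : ∀ O : Op q A, localOp A O =
      ((1 : Op q (Aᶜ : Finset (Fin n))) ⊗ₖ O).submatrix e e := by
    intro O
    ext x y
    exact mul_comm _ _
  have hB : ∀ O : Op q (Aᶜ : Finset (Fin n)), localOp Aᶜ O =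
      (O ⊗ₖ (1 : Op q A)).submatrix e e := by
    intro O
    rw [localOp_compl]
    ext x y
    exact mul_comm _ _
  have hX : X = (X.submatrix e.symm e.symm).submatrix e e := by simp
  conv_lhs => rw [hX]
  simp only [hA, hB, conjTranspose_submatrix, submatrix_mul_equiv]
  have hO : (q : ℂ) ^ Fintype.card (Aᶜ : Finset (Fin n)) • partialTrace A X =
      Matrix.of fun s s' => (q : ℂ) ^ Fintype.card (Aᶜ : Finset (Fin n)) *
        ∑ z, (X.submatrix e.symm e.symm) (z, s) (z, s') := rfl
  rw [hO, ← h]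
  ext x y
  simp only [Matrix.sum_apply, submatrix_apply]

end Split

section LocalOp

variable {q n : ℕ} [NeZero q] (A : Finset (Fin n))

theorem localOp_smul (c : ℂ) (O : Op q A) : localOp A (c • O) = c • localOp A O := by
  rw [localOp, smul_kronecker]; rfl

theorem localOp_sum {κ : Type*} (s : Finset κ) (f : κ → Op q A) :
    localOp A (∑ k ∈ s, f k) = ∑ k ∈ s, localOp A (f k) :=
  map_sum (AddMonoidHom.mk' (localOp A) (localOp_add A)) f s

theorem partialTrace_localOp_mul (O : Op q A) (X : Op q (Fin n)) :
    partialTrace A (localOp A O * X) = O * partialTrace A X := by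
  ext x y
  have h : ∀ b, (localOp A O * X) ((split q A).symm (x, b)) ((split q A).symm (y, b)) =
      ∑ z, O x z * X ((split q A).symm (z, b)) ((split q A).symm (y, b)) := by
    intro b
    rw [Matrix.mul_apply, ← (split q A).symm.sum_comp, Fintype.sum_prod_type]
    refine Finset.sum_congr rfl fun z _ => ?_
    rw [Finset.sum_eq_single b]
    · simp [localOp_apply]
    · intro c _ hc
      simp [localOp_apply, hc.symm]
    · simp
  simp only [partialTrace, Matrix.of_apply, Matrix.mul_apply (M := O), h, Finset.mul_sum]
  exact Finset.sum_comm

end LocalOp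

/-! ### Logical operators and complementary recovery -/

section Code

variable {q n : ℕ} [NeZero q] {S : Subgroup (Matrix.unitaryGroup (Config q (Fin n)) ℂ)}
  {K : ℕ} {V : Matrix (Config q (Fin n)) (Fin K) ℂ} {A : Finset (Fin n)}

/-- `W` and its adjoint preserve the code, the logical operator they induce being `Vᴴ W V`. -/
structure IsLogical (V : Matrix (Config q (Fin n)) (Fin K) ℂ) (W : Op q (Fin n)) : Prop where
  mul_eq : W * V = V * (Vᴴ * W * V)
  conjTranspose_mul_eq : Wᴴ * V = V * (Vᴴ * W * V)ᴴ

theorem IsEncoding.stabilizer_mul (hV : IsEncoding S V)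
    {U : Matrix.unitaryGroup (Config q (Fin n)) ℂ} (hU : U ∈ S) : (U : Op q (Fin n)) * V = V := by
  ext x i
  have hmem : V *ᵥ Pi.single i 1 ∈ codeSpace S := by
    rw [← hV.range_eq]
    exact ⟨_, rfl⟩
  have := congrFun (hmem U hU) x
  rw [mulVec_mulVec] at this
  simpa using this

theorem IsEncoding.mul_conjTranspose_mul (hV : IsEncoding S V) {k : Type*}
    {Y : Matrix (Config q (Fin n)) k ℂ} (hY : ∀ U ∈ S, (U : Op q (Fin n)) * Y = Y) :
    V * (Vᴴ * Y) = Y := by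
  ext x i
  have hmem : (fun x => Y x i) ∈ codeSpace S := by
    intro U hU
    funext x
    exact congrFun (congrFun (hY U hU) x) i
  rw [← hV.range_eq] at hmem
  obtain ⟨v, hv⟩ := hmem
  replace hv : V *ᵥ v = fun x => Y x i := hv
  have h1 : (V * (Vᴴ * Y)) x i = (V *ᵥ (Vᴴ *ᵥ fun x => Y x i)) x := rfl
  rw [h1, ← hv, mulVec_mulVec v, hV.isometry, one_mulVec, hv]

/-- A unitary commuting with the stabilizer up to phases either preserves the code or maps it to an
orthogonal subspace. -/
theorem IsEncoding.isLogical_or (hV : IsEncoding S V) {W : Op q (Fin n)} (hW : Wᴴ * W = 1)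
    (hSW : ∀ U ∈ S, QuasiCommute (U : Op q (Fin n)) W) :
    IsLogical V W ∨ Vᴴ * W * V = 0 := by
  by_cases h : ∀ U ∈ S, (U : Op q (Fin n)) * W = W * U
  · left
    have hW' : W * Wᴴ = 1 := mul_eq_one_comm.1 hW
    constructor
    · rw [Matrix.mul_assoc Vᴴ, hV.mul_conjTranspose_mul]
      intro U hU
      rw [← Matrix.mul_assoc, h U hU, Matrix.mul_assoc, hV.stabilizer_mul hU]
    · rw [conjTranspose_mul, conjTranspose_mul, conjTranspose_conjTranspose,
        hV.mul_conjTranspose_mul]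
      intro U hU
      have h1 : (U : Op q (Fin n)) * Wᴴ = Wᴴ * U := by
        calc (U : Op q (Fin n)) * Wᴴ = Wᴴ * W * (U * Wᴴ) := by rw [hW, Matrix.one_mul]
          _ = Wᴴ * (W * U) * Wᴴ := by simp only [Matrix.mul_assoc]
          _ = Wᴴ * U := by rw [← h U hU]; simp only [Matrix.mul_assoc, hW', Matrix.mul_one]
      rw [← Matrix.mul_assoc, h1, Matrix.mul_assoc, hV.stabilizer_mul hU]
  · right
    push Not at h
    obtain ⟨U, hU, hne⟩ := h
    obtain ⟨z, -, hz⟩ := hSW U hU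
    have hz1 : z ≠ 1 := by
      rintro rfl
      exact hne (by rw [hz, one_smul])
    have hVU : Vᴴ * (U : Op q (Fin n)) = Vᴴ := by
      have h1 := congrArg conjTranspose (hV.stabilizer_mul (S.inv_mem hU))
      rw [conjTranspose_mul] at h1
      have h2 : ((U⁻¹ : Matrix.unitaryGroup (Config q (Fin n)) ℂ) : Op q (Fin n))ᴴ = U := by
        rw [← Matrix.star_eq_conjTranspose, ← Unitary.star_eq_inv, Unitary.coe_star, star_star]
      rwa [h2] at h1
    have h3 : Vᴴ * W * V = z • (Vᴴ * W * V) := by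
      conv_lhs => rw [← hVU, Matrix.mul_assoc Vᴴ, hz, Matrix.mul_smul, Matrix.smul_mul,
        ← Matrix.mul_assoc, Matrix.mul_assoc _ _ V, hV.stabilizer_mul hU]
    have h4 : (1 - z) • (Vᴴ * W * V) = 0 := by rw [sub_smul, one_smul, ← h3, sub_self]
    exact (smul_eq_zero.1 h4).resolve_left (sub_ne_zero.2 (Ne.symm hz1))

namespace IsLogical

variable {W W' : Op q (Fin n)}

theorem logical_mul (h : IsLogical V W') : Vᴴ * W * V * (Vᴴ * W' * V) = Vᴴ * (W * W') * V := by
  rw [Matrix.mul_assoc _ V, ← h.mul_eq]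
  simp only [Matrix.mul_assoc]

theorem logical_mul_conjTranspose (h : IsLogical V W) (hV : Vᴴ * V = 1) (hW : W * Wᴴ = 1) :
    Vᴴ * W * V * (Vᴴ * W * V)ᴴ = 1 := by
  rw [Matrix.mul_assoc _ V, ← h.conjTranspose_mul_eq, Matrix.mul_assoc, ← Matrix.mul_assoc W, hW,
    Matrix.one_mul, hV]

theorem logical_conjTranspose_mul (h : IsLogical V W) (hV : Vᴴ * V = 1) (hW : W * Wᴴ = 1) :
    (Vᴴ * W * V)ᴴ * (Vᴴ * W * V) = 1 :=
  mul_eq_one_comm.1 (h.logical_mul_conjTranspose hV hW)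

end IsLogical

theorem weyl_isLogical_or (hS : S ≤ pauliGroup q n) (hV : IsEncoding S V)
    (l : Config q (Fin n) × Config q (Fin n)) :
    IsLogical V (weyl l) ∨ Vᴴ * weyl l * V = 0 :=
  hV.isLogical_or (conjTranspose_weyl_mul_self l)
    fun _ hU => quasiCommute_weyl_of_mem_pauliGroup (hS hU) l

theorem compression_mem_span (O : Op q A) :
    Vᴴ * localOp A O * V ∈
      Submodule.span ℂ (Set.range fun l : Config q A × Config q A =>
        Vᴴ * localOp A (weyl l) * V) := by
  have hq : (q : ℂ) ^ Fintype.card A ≠ 0 := pow_ne_zero _ (Nat.cast_ne_zero.2 (NeZero.ne q))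
  have hO : O = ((q : ℂ) ^ Fintype.card A)⁻¹ • ∑ l, ((weyl l)ᴴ * O).trace • weyl l := by
    rw [sum_trace_smul_weyl, smul_smul, inv_mul_cancel₀ hq, one_smul]
  rw [hO, localOp_smul, localOp_sum, Matrix.mul_smul, Matrix.smul_mul, Matrix.mul_sum,
    Matrix.sum_mul]
  refine Submodule.smul_mem _ _ (Submodule.sum_mem _ fun l _ => ?_)
  rw [localOp_smul, Matrix.mul_smul, Matrix.smul_mul]
  exact Submodule.smul_mem _ _ (Submodule.subset_span ⟨l, rfl⟩)

/-- The algebra `M_A` is the compression of the full operator algebra of `A` to the code. -/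
theorem mem_codeAlgebra_iff (hS : S ≤ pauliGroup q n) (hV : IsEncoding S V)
    {T : Matrix (Fin K) (Fin K) ℂ} :
    T ∈ codeAlgebra V A ↔ ∃ O : Op q A, T = Vᴴ * localOp A O * V := by
  constructor
  · rintro ⟨O, h, -⟩
    exact ⟨O, by rw [Matrix.mul_assoc, h, ← Matrix.mul_assoc, hV.isometry, Matrix.one_mul]⟩
  · rintro ⟨O, rfl⟩
    refine Submodule.span_le (p := (codeAlgebra V A).toSubalgebra.toSubmodule).2 ?_
      (compression_mem_span O)
    rintro _ ⟨l, rfl⟩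
    rcases weyl_isLogical_or hS hV (extendLabel A l) with h | h
    · rw [← localOp_weyl] at h
      exact ⟨weyl l, h.mul_eq, h.conjTranspose_mul_eq⟩
    · simp only [localOp_weyl, h]
      exact Submodule.zero_mem _

theorem commute_codeAlgebra (hS : S ≤ pauliGroup q n) (hV : IsEncoding S V)
    {X : Matrix (Fin K) (Fin K) ℂ}
    (hX : ∀ l : Config q A × Config q A, Vᴴ * weyl (extendLabel A l) * V * X =
      X * (Vᴴ * weyl (extendLabel A l) * V))
    {T : Matrix (Fin K) (Fin K) ℂ} (hT : T ∈ codeAlgebra V A) : T * X = X * T := by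
  obtain ⟨O, hO⟩ := (mem_codeAlgebra_iff hS hV).1 hT
  have hspan := compression_mem_span (V := V) O
  rw [← hO] at hspan
  clear hO hT
  induction hspan using Submodule.span_induction with
  | mem x hx =>
    obtain ⟨l, rfl⟩ := hx
    simpa only [localOp_weyl] using hX l
  | zero => simp
  | add x y _ _ hx hy => rw [Matrix.add_mul, Matrix.mul_add, hx, hy]
  | smul c x _ hx => rw [Matrix.smul_mul, Matrix.mul_smul, hx]

theorem commute_codeAlgebra_compl (hV : Vᴴ * V = 1) {T T' : Matrix (Fin K) (Fin K) ℂ}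
    (hT : T ∈ codeAlgebra V A) (hT' : T' ∈ codeAlgebra V Aᶜ) : T * T' = T' * T := by
  obtain ⟨O, h, -⟩ := hT
  obtain ⟨O', h', -⟩ := hT'
  have h1 : V * (T * T') = V * (T' * T) := by
    rw [← Matrix.mul_assoc, ← h, Matrix.mul_assoc, ← h', ← Matrix.mul_assoc, localOp_commute,
      Matrix.mul_assoc, h, ← Matrix.mul_assoc, h', Matrix.mul_assoc]
  have h2 := congrArg (fun Y => Vᴴ * Y) h1
  simpa only [← Matrix.mul_assoc, hV, Matrix.one_mul] using h2

open scoped Classical in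
/-- The commutant of `M_A` lies in `M_Ā`. Twirl `V T Vᴴ` over the Weyl operators `U` on `A`. The
outcome is supported on `Ā`, while its compression to the code is a sum of terms `Ū T Ūᴴ` with
`Ū = Vᴴ U V ∈ M_A` zero or unitary. As `T` commutes with `Ū`, the sum is a positive multiple
of `T`. -/
theorem mem_codeAlgebra_compl_of_commute (hS : S ≤ pauliGroup q n) (hV : IsEncoding S V)
    {T : Matrix (Fin K) (Fin K) ℂ} (hT : ∀ X ∈ codeAlgebra V A, X * T = T * X) :
    T ∈ codeAlgebra V Aᶜ := by
  obtain ⟨O, hO⟩ := sum_localOp_weyl_conj A (V * T * Vᴴ)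
  set e : Config q A × Config q A → ℕ := fun l =>
    if IsLogical V (localOp A (weyl l)) then 1 else 0 with he
  have hterm : ∀ l, Vᴴ * (localOp A (weyl l) * (V * T * Vᴴ) * (localOp A (weyl l))ᴴ) * V =
      (e l : ℂ) • T := by
    intro l
    have h1 : Vᴴ * (localOp A (weyl l) * (V * T * Vᴴ) * (localOp A (weyl l))ᴴ) * V =
        (Vᴴ * localOp A (weyl l) * V) * T * (Vᴴ * localOp A (weyl l) * V)ᴴ := by
      simp only [conjTranspose_mul, conjTranspose_conjTranspose, Matrix.mul_assoc]
    rw [h1, hT _ ((mem_codeAlgebra_iff hS hV).2 ⟨_, rfl⟩), Matrix.mul_assoc, he]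
    by_cases h : IsLogical V (localOp A (weyl l))
    · rw [h.logical_mul_conjTranspose hV.isometry
        (by rw [localOp_weyl, weyl_mul_conjTranspose_self])]
      simp [h]
    · have h0 := weyl_isLogical_or hS hV (extendLabel A l)
      rw [← localOp_weyl] at h0
      rw [h0.resolve_left h]
      simp [h]
  have hsum := congrArg (fun Y => Vᴴ * Y * V) hO
  simp only [Matrix.mul_sum, Matrix.sum_mul, hterm] at hsum
  rw [← Finset.sum_smul] at hsum
  have hpos : (∑ l, (e l : ℂ)) ≠ 0 := by
    rw [← Nat.cast_sum, Nat.cast_ne_zero]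
    refine (Finset.sum_pos' (fun _ _ => Nat.zero_le _) ⟨0, Finset.mem_univ _, ?_⟩).ne'
    have h1 : (weyl 0 : Op q A) = 1 := by
      ext x y
      simp [weyl_apply, bichar, Matrix.one_apply]
    have h2 : localOp A (1 : Op q A) = 1 := by
      simpa using localOp_smul_one A (1 : ℂ)
    have h3 : IsLogical V (1 : Op q (Fin n)) := by
      constructor <;> simp [hV.isometry]
    simp [he, h1, h2, h3]
  have hT' : T = (∑ l, (e l : ℂ))⁻¹ • (Vᴴ * localOp Aᶜ O * V) := by
    rw [← hsum, smul_smul, inv_mul_cancel₀ hpos, one_smul]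
  rw [hT']
  exact (codeAlgebra V Aᶜ).smul_mem ((mem_codeAlgebra_iff hS hV).2 ⟨_, rfl⟩) _

theorem mem_codeAlgebra_compl_iff (hS : S ≤ pauliGroup q n) (hV : IsEncoding S V)
    {T : Matrix (Fin K) (Fin K) ℂ} :
    T ∈ codeAlgebra V Aᶜ ↔ ∀ X ∈ codeAlgebra V A, X * T = T * X :=
  ⟨fun hT _ hX => commute_codeAlgebra_compl hV.isometry hX hT,
    mem_codeAlgebra_compl_of_commute hS hV⟩

theorem mem_codeAlgebra_iff_commute_compl (hS : S ≤ pauliGroup q n) (hV : IsEncoding S V)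
    {T : Matrix (Fin K) (Fin K) ℂ} :
    T ∈ codeAlgebra V A ↔ ∀ X ∈ codeAlgebra V Aᶜ, X * T = T * X := by
  rw [← mem_codeAlgebra_compl_iff hS hV, compl_compl]

theorem centralizer_codeAlgebra (hS : S ≤ pauliGroup q n) (hV : IsEncoding S V) :
    StarSubalgebra.centralizer ℂ (codeAlgebra V A : Set (Matrix (Fin K) (Fin K) ℂ)) =
      codeAlgebra V Aᶜ := by
  ext T
  rw [StarSubalgebra.mem_centralizer_iff, mem_codeAlgebra_compl_iff hS hV]
  exact ⟨fun h X hX => (h X hX).1, fun h X hX => ⟨h X hX, h _ (star_mem hX)⟩⟩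

/-- The logical Weyl operators commuting with a family `κ` of Weyl operators form a tight frame of
the commutant of that family: in the Weyl expansion of an `X` in the commutant, every other Weyl
operator is orthogonal to `X`, being multiplied by a nontrivial phase under conjugation by a logical
unitary that fixes `X`. -/
theorem sum_trace_smul_logical (hS : S ≤ pauliGroup q n) (hV : IsEncoding S V)
    (κ : Set (Config q (Fin n) × Config q (Fin n)))
    (F : Finset (Config q (Fin n) × Config q (Fin n)))
    (hF : ∀ l, l ∈ F ↔ IsLogical V (weyl l) ∧ ∀ k ∈ κ,
      Vᴴ * weyl k * V * (Vᴴ * weyl l * V) = Vᴴ * weyl l * V * (Vᴴ * weyl k * V))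
    {X : Matrix (Fin K) (Fin K) ℂ}
    (hX : ∀ k ∈ κ, Vᴴ * weyl k * V * X = X * (Vᴴ * weyl k * V)) :
    ∑ l ∈ F, ((Vᴴ * weyl l * V)ᴴ * X).trace • (Vᴴ * weyl l * V) = (q : ℂ) ^ n • X := by
  have hfull : ∑ l : Config q (Fin n) × Config q (Fin n),
      ((Vᴴ * weyl l * V)ᴴ * X).trace • (Vᴴ * weyl l * V) = (q : ℂ) ^ n • X := by
    have h := congrArg (fun Y => Vᴴ * Y * V) (sum_trace_smul_weyl (V * X * Vᴴ))
    simp only [Matrix.mul_sum, Matrix.sum_mul, Matrix.mul_smul, Matrix.smul_mul,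
      Fintype.card_fin] at h
    have h1 : Vᴴ * (V * X * Vᴴ) * V = X := by
      simp only [← Matrix.mul_assoc, hV.isometry, Matrix.one_mul]
      rw [Matrix.mul_assoc, hV.isometry, Matrix.mul_one]
    rw [h1] at h
    rw [← h]
    refine Finset.sum_congr rfl fun l _ => ?_
    congr 1
    rw [← Matrix.mul_assoc (weyl l)ᴴ, Matrix.trace_mul_comm _ Vᴴ]
    simp only [conjTranspose_mul, conjTranspose_conjTranspose, Matrix.mul_assoc]
  rw [← hfull]
  refine Finset.sum_subset (Finset.subset_univ _) fun l _ hl => ?_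
  rcases weyl_isLogical_or hS hV l with hlog | h0
  swap
  · rw [h0, smul_zero]
  have hex : ∃ k ∈ κ, Vᴴ * weyl k * V * (Vᴴ * weyl l * V) ≠
      Vᴴ * weyl l * V * (Vᴴ * weyl k * V) := by
    by_contra! hall
    exact hl ((hF l).2 ⟨hlog, hall⟩)
  obtain ⟨k, hk, hne⟩ := hex
  have hklog : IsLogical V (weyl k) := by
    refine (weyl_isLogical_or hS hV k).resolve_right fun h0 => hne ?_
    rw [h0, Matrix.zero_mul, Matrix.mul_zero]
  obtain ⟨z, hz⟩ : ∃ z : ℂ, Vᴴ * weyl k * V * (Vᴴ * weyl l * V) =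
      z • (Vᴴ * weyl l * V * (Vᴴ * weyl k * V)) := by
    refine ⟨bichar k.2 l.1 * (bichar l.2 k.1)⁻¹, ?_⟩
    rw [hlog.logical_mul, hklog.logical_mul, weyl_mul_weyl_comm k l, Matrix.mul_smul,
      Matrix.smul_mul]
  have hk1 := hklog.logical_conjTranspose_mul hV.isometry (weyl_mul_conjTranspose_self k)
  have hk2 := hklog.logical_mul_conjTranspose hV.isometry (weyl_mul_conjTranspose_self k)
  have hXk := hX k hk
  set P := Vᴴ * weyl k * V
  set Q := Vᴴ * weyl l * V
  have hz1 : z ≠ 1 := by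
    rintro rfl
    exact hne (by rw [hz, one_smul])
  have hzH : Qᴴ * Pᴴ = conj z • (Pᴴ * Qᴴ) := by
    have := congrArg conjTranspose hz
    simpa [conjTranspose_mul, conjTranspose_smul] using this
  have htr : (Qᴴ * X).trace = conj z * (Qᴴ * X).trace := by
    calc (Qᴴ * X).trace = (Qᴴ * Pᴴ * (P * X)).trace := by
          rw [Matrix.mul_assoc, ← Matrix.mul_assoc Pᴴ, hk1, Matrix.one_mul]
      _ = conj z * (Pᴴ * (Qᴴ * X * P)).trace := by
          rw [hzH, hXk, Matrix.smul_mul, trace_smul, smul_eq_mul]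
          simp only [Matrix.mul_assoc]
      _ = conj z * (Qᴴ * X).trace := by
          rw [Matrix.trace_mul_comm, Matrix.mul_assoc (Qᴴ * X), hk2, Matrix.mul_one]
  have h5 : (1 - conj z) * (Qᴴ * X).trace = 0 := by
    rw [sub_mul, one_mul, ← htr, sub_self]
  have h6 : 1 - conj z ≠ 0 := by
    intro h
    apply hz1
    have := congrArg conj (sub_eq_zero.1 h)
    simpa using this.symm
  rw [(mul_eq_zero.1 h5).resolve_left h6, zero_smul]

variable (V A) in
open scoped Classical in
/-- The nonzero eigenvalue of `Tr_Ā (V Vᴴ)`, expressed by a count of the Weyl operators on `Ā`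
that preserve the code. -/
noncomputable def flatness : ℝ :=
  ({l | IsLogical V (localOp Aᶜ (weyl l))} : Finset (Config q (Aᶜ : Finset (Fin n)) × _)).card /
    (q : ℝ) ^ Fintype.card (Aᶜ : Finset (Fin n))

/-- The reduced operator `R` of the code projection has a flat spectrum. As a twirl over the Weyl
operators `U` on `Ā`, it satisfies `(R ⊗ 1) V = μ V`: a term with `U` preserving the code
contributes `V`, every other term `0`. Then `R² = Tr_Ā ((R ⊗ 1) V Vᴴ) = μ R`. -/
theorem partialTrace_codeProjection_sq (hS : S ≤ pauliGroup q n) (hV : IsEncoding S V) :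
    partialTrace A (V * Vᴴ) * partialTrace A (V * Vᴴ) =
      (flatness V A : ℂ) • partialTrace A (V * Vᴴ) := by
  classical
  have hq : (q : ℂ) ^ Fintype.card (Aᶜ : Finset (Fin n)) ≠ 0 :=
    pow_ne_zero _ (Nat.cast_ne_zero.2 (NeZero.ne q))
  have h := congrArg (fun Y => Y * V) (sum_localOp_compl_weyl_conj A (V * Vᴴ))
  have hterm : ∀ l, localOp Aᶜ (weyl l) * (V * Vᴴ) * (localOp Aᶜ (weyl l))ᴴ * V =
      if IsLogical V (localOp Aᶜ (weyl l)) then V else 0 := by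
    intro l
    have h1 : localOp Aᶜ (weyl l) * (V * Vᴴ) * (localOp Aᶜ (weyl l))ᴴ * V =
        localOp Aᶜ (weyl l) * (V * (Vᴴ * localOp Aᶜ (weyl l) * V)ᴴ) := by
      simp only [conjTranspose_mul, conjTranspose_conjTranspose, Matrix.mul_assoc]
    rw [h1]
    split_ifs with hl
    · rw [← hl.conjTranspose_mul_eq, ← Matrix.mul_assoc, localOp_weyl, weyl_mul_conjTranspose_self,
        Matrix.one_mul]
    · have h0 := weyl_isLogical_or hS hV (extendLabel Aᶜ l)
      rw [← localOp_weyl] at h0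
      rw [h0.resolve_left hl]
      simp
  simp only [Matrix.sum_mul, hterm, localOp_smul, Matrix.smul_mul] at h
  rw [← Finset.sum_filter, Finset.sum_const] at h
  have hRV : localOp A (partialTrace A (V * Vᴴ)) * V = (flatness V A : ℂ) • V := by
    have h2 := congrArg (fun Y => ((q : ℂ) ^ Fintype.card (Aᶜ : Finset (Fin n)))⁻¹ • Y) h
    simp only [smul_smul, inv_mul_cancel₀ hq, one_smul] at h2
    rw [← h2, ← Nat.cast_smul_eq_nsmul ℂ, smul_smul, flatness, mul_comm]
    push_cast
    rw [div_eq_mul_inv]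
  rw [← partialTrace_localOp_mul, ← Matrix.mul_assoc, hRV, Matrix.smul_mul]
  ext x y
  simp [partialTrace, Finset.mul_sum]

end Code

/-! ### Existence of a decomposition -/

section Existence

variable {q n : ℕ} [NeZero q] {A : Finset (Fin n)}

theorem mul_blockDiagonal'_one_kronecker {N : ℕ} {a b : Fin N → ℕ} {l : Type*}
    (X : Matrix l (Σ α, Fin (a α) × Fin (b α)) ℂ)
    (O : ∀ α, Matrix (Fin (b α)) (Fin (b α)) ℂ) (x : l) (α : Fin N) (i : Fin (a α))
    (j : Fin (b α)) :
    (X * blockDiagonal' fun α => (1 : Matrix (Fin (a α)) (Fin (a α)) ℂ) ⊗ₖ O α) x ⟨α, (i, j)⟩ =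
      ∑ j', X x ⟨α, (i, j')⟩ * O α j' j := by
  rw [Matrix.mul_apply, Fintype.sum_sigma, Finset.sum_eq_single α]
  · rw [Fintype.sum_prod_type, Finset.sum_eq_single i]
    · refine Finset.sum_congr rfl fun j' _ => ?_
      simp
    · intro i' _ hi
      refine Finset.sum_eq_zero fun j' _ => ?_
      simp [hi]
    · simp
  · intro β _ hβ
    refine Finset.sum_eq_zero fun y _ => ?_
    rw [blockDiagonal'_apply_ne _ _ _ hβ, mul_zero]
  · simp

/-- A vector of `H = H_A ⊗ H_Ā` as a matrix with rows indexed by `A` and columns by `Ā`. -/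
def unvec (A : Finset (Fin n)) (ψ : Config q (Fin n) → ℂ) :
    Matrix (Config q A) (Config q (Aᶜ : Finset (Fin n))) ℂ :=
  Matrix.of fun x y => ψ ((split q A).symm (x, y))

theorem unvec_localOp_mulVec (O : Op q A) (ψ : Config q (Fin n) → ℂ) :
    unvec A (localOp A O *ᵥ ψ) = O * unvec A ψ := by
  ext x y
  rw [unvec, Matrix.of_apply, mulVec, dotProduct, ← (split q A).symm.sum_comp,
    Fintype.sum_prod_type, Matrix.mul_apply]
  refine Finset.sum_congr rfl fun z _ => ?_
  rw [Finset.sum_eq_single y]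
  · simp [localOp_apply, unvec]
  · intro c _ hc
    simp [localOp_apply, hc.symm]
  · simp

theorem unvec_localOp_compl_mulVec (O : Op q (Aᶜ : Finset (Fin n)))
    (ψ : Config q (Fin n) → ℂ) :
    unvec A (localOp Aᶜ O *ᵥ ψ) = unvec A ψ * Oᵀ := by
  ext x y
  rw [unvec, Matrix.of_apply, mulVec, dotProduct, ← (split q A).symm.sum_comp,
    Fintype.sum_prod_type, Matrix.mul_apply, Finset.sum_eq_single x]
  · refine Finset.sum_congr rfl fun z _ => ?_
    simp [localOp_compl, unvec, mul_comm]
  · intro c _ hc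
    refine Finset.sum_eq_zero fun z _ => ?_
    simp [localOp_compl, hc.symm]
  · simp

theorem unvec_zero : unvec (q := q) A 0 = 0 := rfl

theorem mulVec_column {l m k : Type*} [Fintype m] {M : Matrix l m ℂ} {C : Matrix m k ℂ}
    {C' : Matrix l k ℂ} (h : M * C = C') (y : k) : (M *ᵥ fun x => C x y) = fun x => C' x y :=
  funext fun x => congrFun (congrFun h x) y

/-- A logical operator with matrix `D` in the basis `B`, if it belongs to `M_A`, is implemented on
`A` together with its adjoint. -/
theorem exists_localOp_of_mem {K : ℕ} {V : Matrix (Config q (Fin n)) (Fin K) ℂ} {J : Type*}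
    [Fintype J] [DecidableEq J] {B : Matrix (Fin K) J ℂ} (hB : Bᴴ * B = 1) {D : Matrix J J ℂ}
    (h : B * D * Bᴴ ∈ codeAlgebra V A) :
    ∃ O : Op q A, localOp A O * (V * B) = V * B * D ∧ (localOp A O)ᴴ * (V * B) = V * B * Dᴴ := by
  obtain ⟨O, h1, h2⟩ := h
  refine ⟨O, ?_, ?_⟩
  · rw [← Matrix.mul_assoc, h1]
    simp only [Matrix.mul_assoc, hB, Matrix.mul_one]
  · rw [← Matrix.mul_assoc, h2]
    simp only [conjTranspose_mul, conjTranspose_conjTranspose, Matrix.mul_assoc, hB,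
      Matrix.mul_one]

/-- A decomposition exists. In a Wedderburn basis of `M_A` the matrix units `|α, i⟩⟨α, 0|` and
`|α, j⟩⟨α, 0|` of `M_A` and of its commutant `M_Ā` are implemented by operators `E` on `A` and `F`
on `Ā`. With `V |α, 0 0⟩` written as a matrix `Ψ = u χ wᵀ`, where `u` and `w` are orthonormal
bases of the ranges of `Ψ` and `Ψᵀ`, the isometries `U_A` and `U_Ā` have blocks `E u` and `F w`.
Their orthonormality follows from `u = Ψ v`, because `Eᴴ E` acts on `Ψ` as a product of matrix
units. -/
theorem nonempty_decomposition {S : Subgroup (Matrix.unitaryGroup (Config q (Fin n)) ℂ)}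
    (hS : S ≤ pauliGroup q n) {K : ℕ} {V : Matrix (Config q (Fin n)) (Fin K) ℂ}
    (hV : IsEncoding S V) : Nonempty (Decomposition V A) := by
  obtain ⟨N, a, b, B, ha, hb, hB, hB', hM⟩ := exists_wedderburn (codeAlgebra V A)
  -- the logical matrix units of `M_A` and of its commutant `M_Ā`
  have hEmem : ∀ O : ∀ α, Matrix (Fin (a α)) (Fin (a α)) ℂ,
      B * (blockDiagonal' fun α => O α ⊗ₖ (1 : Matrix (Fin (b α)) (Fin (b α)) ℂ)) * Bᴴ ∈
        codeAlgebra V A := by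
    intro O
    rw [hM]
    exact ⟨O, by rw [Matrix.mul_assoc, hB, Matrix.mul_one]⟩
  have hFmem : ∀ O : ∀ α, Matrix (Fin (b α)) (Fin (b α)) ℂ,
      B * (blockDiagonal' fun α => (1 : Matrix (Fin (a α)) (Fin (a α)) ℂ) ⊗ₖ O α) * Bᴴ ∈
        codeAlgebra V Aᶜ := by
    intro Y
    rw [mem_codeAlgebra_compl_iff hS hV]
    intro X hX
    obtain ⟨O, hO⟩ := (hM X).1 hX
    have hX' : X = B * (blockDiagonal' fun α => O α ⊗ₖ (1 : Matrix (Fin (b α)) (Fin (b α)) ℂ)) *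
        Bᴴ := by
      rw [← hO, Matrix.mul_assoc, hB', Matrix.mul_one]
    have hcomm : (blockDiagonal' fun α => O α ⊗ₖ (1 : Matrix (Fin (b α)) (Fin (b α)) ℂ)) *
          (blockDiagonal' fun α => (1 : Matrix (Fin (a α)) (Fin (a α)) ℂ) ⊗ₖ Y α) =
        (blockDiagonal' fun α => (1 : Matrix (Fin (a α)) (Fin (a α)) ℂ) ⊗ₖ Y α) *
          (blockDiagonal' fun α => O α ⊗ₖ (1 : Matrix (Fin (b α)) (Fin (b α)) ℂ)) := by
      rw [← blockDiagonal'_mul, ← blockDiagonal'_mul]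
      simp only [← mul_kronecker_mul, Matrix.one_mul, Matrix.mul_one]
    have hprod : ∀ D D' : Matrix (Σ α, Fin (a α) × Fin (b α)) (Σ α, Fin (a α) × Fin (b α)) ℂ,
        B * D * Bᴴ * (B * D' * Bᴴ) = B * (D * D') * Bᴴ := by
      intro D D'
      simp only [Matrix.mul_assoc]
      rw [← Matrix.mul_assoc Bᴴ, hB, Matrix.one_mul]
    rw [hX', hprod, hprod, hcomm]
  let i₀ : ∀ α, Fin (a α) := fun α => ⟨0, ha α⟩
  let j₀ : ∀ α, Fin (b α) := fun α => ⟨0, hb α⟩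
  choose E hE hE' using fun α i => exists_localOp_of_mem hB
    (hEmem (Pi.single α (Matrix.single i (i₀ α) 1)))
  choose F hF hF' using fun α j => exists_localOp_of_mem hB
    (hFmem (Pi.single α (Matrix.single j (j₀ α) 1)))
  let Ψ : ∀ α, Fin (a α) → Fin (b α) →
      Matrix (Config q A) (Config q (Aᶜ : Finset (Fin n))) ℂ :=
    fun α i j => unvec A fun x => (V * B) x ⟨α, (i, j)⟩
  have hEΨ : ∀ α i j, E α i * Ψ α (i₀ α) j = Ψ α i j := by
    intro α i j
    rw [← unvec_localOp_mulVec]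
    congr 1
    funext x
    refine (congrFun (congrFun (hE α i) x) ⟨α, (i₀ α, j)⟩).trans ?_
    rw [mul_blockDiagonal'_kronecker_one, Finset.sum_eq_single i]
    · simp
    · intro i' _ hi'
      simp [hi'.symm]
    · simp
  have hEΨ' : ∀ α i i' j, (E α i)ᴴ * Ψ α i' j = if i = i' then Ψ α (i₀ α) j else 0 := by
    intro α i i' j
    have h : (fun x => (V * B * (blockDiagonal' fun β =>
        (Pi.single α (Matrix.single i (i₀ α) 1) : ∀ α, Matrix (Fin (a α)) (Fin (a α)) ℂ) β ⊗ₖ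
          (1 : Matrix (Fin (b β)) (Fin (b β)) ℂ))ᴴ) x ⟨α, (i', j)⟩) =
        if i = i' then (fun x => (V * B) x ⟨α, (i₀ α, j)⟩) else 0 := by
      funext x
      rw [blockDiagonal'_conjTranspose]
      simp only [conjTranspose_kronecker, conjTranspose_one]
      rw [mul_blockDiagonal'_kronecker_one, Finset.sum_eq_single (i₀ α)]
      · by_cases hi : i = i' <;> simp [hi]
      · intro i'' _ hi''
        simp [hi''.symm]
      · simp
    rw [← unvec_localOp_mulVec]
    have h2 := mulVec_column (hE' α i) ⟨α, (i', j)⟩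
    rw [← localOp_conjTranspose] at h2
    rw [h2, h]
    split_ifs <;> rfl
  have hEΨ0 : ∀ α β, α ≠ β → ∀ i i' j, (E α i)ᴴ * Ψ β i' j = 0 := by
    intro α β hne i i' j
    have h2 := mulVec_column (hE' α i) ⟨β, (i', j)⟩
    rw [← localOp_conjTranspose] at h2
    rw [← unvec_localOp_mulVec, h2, ← unvec_zero]
    congr 1
    funext x
    rw [blockDiagonal'_conjTranspose]
    simp only [conjTranspose_kronecker, conjTranspose_one]
    rw [mul_blockDiagonal'_kronecker_one]
    simp [Pi.single_eq_of_ne (Ne.symm hne)]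
  have hFΨ : ∀ α i j, Ψ α i (j₀ α) * (F α j)ᵀ = Ψ α i j := by
    intro α i j
    rw [← unvec_localOp_compl_mulVec]
    congr 1
    funext x
    refine (congrFun (congrFun (hF α j) x) ⟨α, (i, j₀ α)⟩).trans ?_
    rw [mul_blockDiagonal'_one_kronecker, Finset.sum_eq_single j]
    · simp
    · intro j' _ hj'
      simp [hj'.symm]
    · simp
  have hFΨ' : ∀ α i j j', Ψ α i j' * ((F α j)ᴴ)ᵀ = if j = j' then Ψ α i (j₀ α) else 0 := by
    intro α i j j'
    have h : (fun x => (V * B * (blockDiagonal' fun β =>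
        (1 : Matrix (Fin (a β)) (Fin (a β)) ℂ) ⊗ₖ (Pi.single α (Matrix.single j (j₀ α) 1) :
          ∀ α, Matrix (Fin (b α)) (Fin (b α)) ℂ) β)ᴴ) x ⟨α, (i, j')⟩) =
        if j = j' then (fun x => (V * B) x ⟨α, (i, j₀ α)⟩) else 0 := by
      funext x
      rw [blockDiagonal'_conjTranspose]
      simp only [conjTranspose_kronecker, conjTranspose_one]
      rw [mul_blockDiagonal'_one_kronecker, Finset.sum_eq_single (j₀ α)]
      · by_cases hj : j = j' <;> simp [hj]
      · intro j'' _ hj''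
        simp [hj''.symm]
      · simp
    rw [← unvec_localOp_compl_mulVec]
    have h2 := mulVec_column (hF' α j) ⟨α, (i, j')⟩
    rw [← localOp_conjTranspose] at h2
    rw [h2, h]
    split_ifs <;> rfl
  have hFΨ0 : ∀ α β, α ≠ β → ∀ i j j', Ψ β i j' * ((F α j)ᴴ)ᵀ = 0 := by
    intro α β hne i j j'
    have h2 := mulVec_column (hF' α j) ⟨β, (i, j')⟩
    rw [← localOp_conjTranspose] at h2
    rw [← unvec_localOp_compl_mulVec, h2, ← unvec_zero]
    congr 1
    funext x
    rw [blockDiagonal'_conjTranspose]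
    simp only [conjTranspose_kronecker, conjTranspose_one]
    rw [mul_blockDiagonal'_one_kronecker]
    simp [Pi.single_eq_of_ne (Ne.symm hne)]
  -- `H_{A₂}` and `H_{Ā₂}` are the supports of the two reduced states of `V |α, 0 0⟩`
  choose r u v hu huv huΨ using fun α => exists_orthonormal_range (Ψ α (i₀ α) (j₀ α))
  choose r' w z hw hwz hwΨ using fun α => exists_orthonormal_range (Ψ α (i₀ α) (j₀ α))ᵀ
  have hwΨ' : ∀ α, Ψ α (i₀ α) (j₀ α) * (((w α)ᴴ)ᵀ * (w α)ᵀ) = Ψ α (i₀ α) (j₀ α) := by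
    intro α
    have := congrArg transpose (hwΨ α)
    simpa only [transpose_mul, transpose_transpose, Matrix.mul_assoc] using this
  refine ⟨{
    numBlocks := N
    dimA₁ := a
    dimB₁ := b
    dimA₂ := r
    dimB₂ := r'
    dimA₁_pos := ha
    dimB₁_pos := hb
    basis := B
    basis_orthonormal := hB
    basis_complete := hB'
    mem_algebra := hM
    isoA := Matrix.of fun x y => (E y.1 y.2.1 * u y.1) x y.2.2
    isoA_isometry := ?_
    isoB := Matrix.of fun x y => (F y.1 y.2.1 * w y.1) x y.2.2
    isoB_isometry := ?_
    χ := fun α => (u α)ᴴ * Ψ α (i₀ α) (j₀ α) * ((w α)ᴴ)ᵀ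
    χ_unit := ?_
    encoded_basis := ?_ }⟩
  · ext ⟨α, i, s⟩ ⟨β, i', s'⟩
    have h1 : ((E α i * u α)ᴴ * (E β i' * u β)) s s' =
        (1 : Matrix (Σ α, Fin (a α) × Fin (r α)) (Σ α, Fin (a α) × Fin (r α)) ℂ)
          ⟨α, i, s⟩ ⟨β, i', s'⟩ := by
      have h2 : E β i' * u β = Ψ β i' (j₀ β) * v β := by
        conv_lhs => rw [huv, ← Matrix.mul_assoc, hEΨ]
      rw [h2, conjTranspose_mul, Matrix.mul_assoc, ← Matrix.mul_assoc (E α i)ᴴ]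
      by_cases hαβ : α = β
      · subst hαβ
        rw [hEΨ']
        by_cases hi : i = i'
        · subst hi
          rw [if_pos rfl, ← huv, hu]
          simp [Matrix.one_apply]
        · simp [hi]
      · rw [hEΨ0 α β hαβ]
        simp [hαβ]
    exact h1
  · ext ⟨α, j, t⟩ ⟨β, j', t'⟩
    have h1 : ((F α j * w α)ᴴ * (F β j' * w β)) t t' =
        (1 : Matrix (Σ α, Fin (b α) × Fin (r' α)) (Σ α, Fin (b α) × Fin (r' α)) ℂ)
          ⟨α, j, t⟩ ⟨β, j', t'⟩ := by
      have h2 : F β j' * w β = (Ψ β (i₀ β) j')ᵀ * z β := by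
        conv_lhs => rw [hwz, ← Matrix.mul_assoc, ← transpose_transpose (F β j'), ← transpose_mul,
          hFΨ]
      rw [h2, conjTranspose_mul, Matrix.mul_assoc, ← Matrix.mul_assoc (F α j)ᴴ,
        ← transpose_transpose (F α j)ᴴ, ← transpose_mul]
      by_cases hαβ : α = β
      · subst hαβ
        rw [hFΨ']
        by_cases hj : j = j'
        · subst hj
          rw [if_pos rfl, ← hwz, hw]
          simp [Matrix.one_apply]
        · simp [hj]
      · rw [hFΨ0 α β hαβ]
        simp [hαβ]
    exact h1
  · intro α
    set X := Ψ α (i₀ α) (j₀ α) with hX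
    have hnorm : ∀ {l k : Type} [Fintype l] [Fintype k] (M : Matrix l k ℂ),
        ((∑ s, ∑ t, ‖M s t‖ ^ 2 : ℝ) : ℂ) = (Mᴴ * M).trace := by
      intro l k _ _ M
      simp only [Matrix.trace, Matrix.diag, Matrix.mul_apply, conjTranspose_apply]
      rw [Finset.sum_comm]
      push_cast
      refine Finset.sum_congr rfl fun t _ => Finset.sum_congr rfl fun s _ => ?_
      rw [Complex.star_def, Complex.conj_mul']
    have h1 : (((u α)ᴴ * X * ((w α)ᴴ)ᵀ)ᴴ * ((u α)ᴴ * X * ((w α)ᴴ)ᵀ)).trace = (Xᴴ * X).trace := by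
      have hwt : (((w α)ᴴ)ᵀ)ᴴ = (w α)ᵀ := by
        ext
        simp
      rw [conjTranspose_mul, conjTranspose_mul, conjTranspose_conjTranspose, hwt,
        Matrix.mul_assoc, Matrix.trace_mul_comm]
      have h2 : Xᴴ * u α * ((u α)ᴴ * X * ((w α)ᴴ)ᵀ) * (w α)ᵀ =
          Xᴴ * (u α * (u α)ᴴ * (X * (((w α)ᴴ)ᵀ * (w α)ᵀ))) := by
        simp only [Matrix.mul_assoc]
      rw [h2, hwΨ' α, huΨ α]
    have h2 : (Xᴴ * X).trace = 1 := by
      have hC : (V * B)ᴴ * (V * B) = 1 := by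
        rw [conjTranspose_mul, Matrix.mul_assoc, ← Matrix.mul_assoc Vᴴ, hV.isometry,
          Matrix.one_mul, hB]
      have h3 := congrFun (congrFun hC ⟨α, (i₀ α, j₀ α)⟩) ⟨α, (i₀ α, j₀ α)⟩
      rw [one_apply_eq, Matrix.mul_apply, ← (split q A).symm.sum_comp,
        Fintype.sum_prod_type, Finset.sum_comm] at h3
      rw [← h3]
      simp only [Matrix.trace, Matrix.diag, Matrix.mul_apply (M := Xᴴ)]
      rfl
    have h3 := hnorm ((u α)ᴴ * X * ((w α)ᴴ)ᵀ)
    rw [h1, h2] at h3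
    exact_mod_cast h3
  · intro x α i j
    have h1 : Ψ α i j = (E α i * u α) * ((u α)ᴴ * Ψ α (i₀ α) (j₀ α) * ((w α)ᴴ)ᵀ) *
        (F α j * w α)ᵀ := by
      have h2 : (E α i * u α) * ((u α)ᴴ * Ψ α (i₀ α) (j₀ α) * ((w α)ᴴ)ᵀ) * (F α j * w α)ᵀ =
          E α i * (u α * (u α)ᴴ * (Ψ α (i₀ α) (j₀ α) * (((w α)ᴴ)ᵀ * (w α)ᵀ))) * (F α j)ᵀ := by
        simp only [transpose_mul, Matrix.mul_assoc]
      rw [h2, hwΨ' α, huΨ α, hEΨ, hFΨ]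
    have h3 := congrFun (congrFun h1 (split q A x).1) (split q A x).2
    have h4 : Ψ α i j (split q A x).1 (split q A x).2 = (V * B) x ⟨α, (i, j)⟩ := by
      simp [Ψ, unvec]
    rw [← h4, h3, Matrix.mul_apply]
    simp only [Matrix.mul_apply (M := E α i * u α), Finset.sum_mul]
    rw [Finset.sum_comm]
    refine Finset.sum_congr rfl fun s _ => Finset.sum_congr rfl fun t _ => ?_
    simp only [transpose_apply, Matrix.of_apply]
    ring

end Existence

/-! ### The reduced state and the Ryu–Takayanagi formula -/

section ReducedState

variable {q n : ℕ} [NeZero q] {K : ℕ} {V : Matrix (Config q (Fin n)) (Fin K) ℂ}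
  {A : Finset (Fin n)}

theorem partialTrace_mul_mul_conjTranspose {J : Type*} [Fintype J]
    (C : Matrix (Config q (Fin n)) J ℂ) (M : Matrix J J ℂ) :
    partialTrace A (C * M * Cᴴ) = ∑ y, ∑ y', M y y' •
      (unvec A (fun x => C x y) * (unvec A fun x => C x y')ᴴ) := by
  ext x x'
  simp only [partialTrace, Matrix.of_apply, Matrix.sum_apply, Matrix.smul_apply, smul_eq_mul]
  have h : ∀ b, (C * M * Cᴴ) ((split q A).symm (x, b)) ((split q A).symm (x', b)) =
      ∑ y, ∑ y', M y y' * (C ((split q A).symm (x, b)) y *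
        star (C ((split q A).symm (x', b)) y')) := by
    intro b
    simp only [Matrix.mul_apply, conjTranspose_apply, Finset.sum_mul]
    rw [Finset.sum_comm]
    refine Finset.sum_congr rfl fun y _ => Finset.sum_congr rfl fun y' _ => ?_
    ring
  simp only [h]
  rw [Finset.sum_comm]
  refine Finset.sum_congr rfl fun y _ => ?_
  rw [Finset.sum_comm]
  refine Finset.sum_congr rfl fun y' _ => ?_
  rw [← Finset.mul_sum]
  rfl

namespace Decomposition

variable (D : Decomposition V A)

theorem reducedχ_eq (α : Fin D.numBlocks) : D.reducedχ α = D.χ α * (D.χ α)ᴴ := rfl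

theorem reducedχ_isHermitian (α : Fin D.numBlocks) : (D.reducedχ α).IsHermitian := by
  rw [reducedχ_eq]
  exact isHermitian_mul_conjTranspose_self _

theorem trace_reducedχ (α : Fin D.numBlocks) : (D.reducedχ α).trace = 1 := by
  have h : (D.reducedχ α).trace = ((∑ s, ∑ t, ‖D.χ α s t‖ ^ 2 : ℝ) : ℂ) := by
    simp only [Matrix.trace, Matrix.diag, reducedχ, Matrix.of_apply]
    push_cast
    refine Finset.sum_congr rfl fun s _ => Finset.sum_congr rfl fun t _ => ?_
    rw [Complex.mul_conj']
  rw [h, D.χ_unit, Complex.ofReal_one]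

theorem block_isHermitian {ρ : Matrix (Fin K) (Fin K) ℂ} (hρ : ρ.IsHermitian)
    (α : Fin D.numBlocks) : (D.block ρ α).IsHermitian := by
  ext i i'
  have h : (D.basisᴴ * ρ * D.basis)ᴴ = D.basisᴴ * ρ * D.basis := by
    simp only [conjTranspose_mul, conjTranspose_conjTranspose, hρ.eq, Matrix.mul_assoc]
  simp only [conjTranspose_apply, block, Matrix.of_apply, star_sum]
  refine Finset.sum_congr rfl fun j _ => ?_
  exact congrFun (congrFun h _) _

theorem unvec_encoded (α : Fin D.numBlocks) (i : Fin (D.dimA₁ α)) (j : Fin (D.dimB₁ α)) :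
    (unvec A fun x => (V * D.basis) x ⟨α, (i, j)⟩) =
      (Matrix.of fun x s => D.isoA x ⟨α, (i, s)⟩) * D.χ α *
        (Matrix.of fun y t => D.isoB y ⟨α, (j, t)⟩)ᵀ := by
  ext x y
  rw [unvec, Matrix.of_apply, D.encoded_basis, Equiv.apply_symm_apply]
  simp only [Matrix.mul_apply, Finset.sum_mul, Matrix.of_apply, transpose_apply]
  rw [Finset.sum_comm]
  refine Finset.sum_congr rfl fun t _ => Finset.sum_congr rfl fun s _ => ?_
  ring

theorem unvec_encoded_mul_conjTranspose (α β : Fin D.numBlocks) (i : Fin (D.dimA₁ α))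
    (i' : Fin (D.dimA₁ β)) (j : Fin (D.dimB₁ α)) (j' : Fin (D.dimB₁ β)) :
    (unvec A fun x => (V * D.basis) x ⟨α, (i, j)⟩) *
        (unvec A fun x => (V * D.basis) x ⟨β, (i', j')⟩)ᴴ =
      (Matrix.of fun x s => D.isoA x ⟨α, (i, s)⟩) * (D.χ α * (Matrix.of fun t t' =>
        (1 : Matrix (Σ α, Fin (D.dimB₁ α) × Fin (D.dimB₂ α))
          (Σ α, Fin (D.dimB₁ α) × Fin (D.dimB₂ α)) ℂ) ⟨α, (j, t)⟩ ⟨β, (j', t')⟩) * (D.χ β)ᴴ) *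
        (Matrix.of fun x s => D.isoA x ⟨β, (i', s)⟩)ᴴ := by
  rw [unvec_encoded, unvec_encoded]
  have h : (Matrix.of fun y t => D.isoB y ⟨α, (j, t)⟩)ᵀ *
      ((Matrix.of fun y t => D.isoB y ⟨β, (j', t)⟩)ᵀ)ᴴ = Matrix.of fun t t' =>
        (1 : Matrix (Σ α, Fin (D.dimB₁ α) × Fin (D.dimB₂ α))
          (Σ α, Fin (D.dimB₁ α) × Fin (D.dimB₂ α)) ℂ) ⟨α, (j, t)⟩ ⟨β, (j', t')⟩ := by
    ext t t'
    have h1 := congrFun (congrFun (congrArg transpose D.isoB_isometry) ⟨α, (j, t)⟩) ⟨β, (j', t')⟩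
    rw [transpose_one] at h1
    rw [Matrix.of_apply, ← h1]
    simp only [Matrix.mul_apply, transpose_apply, conjTranspose_apply, Matrix.of_apply]
    exact Finset.sum_congr rfl fun y _ => mul_comm _ _
  rw [← h]
  simp only [conjTranspose_mul, Matrix.mul_assoc]

theorem isoA_mul_blockDiagonal'_mul (ρ : ∀ α, Matrix (Fin (D.dimA₁ α)) (Fin (D.dimA₁ α)) ℂ)
    (χ : ∀ α, Matrix (Fin (D.dimA₂ α)) (Fin (D.dimA₂ α)) ℂ) :
    D.isoA * blockDiagonal' (fun α => ρ α ⊗ₖ χ α) * D.isoAᴴ = ∑ α, ∑ i, ∑ i', ρ α i i' •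
      ((Matrix.of fun x s => D.isoA x ⟨α, (i, s)⟩) * χ α *
        (Matrix.of fun x s => D.isoA x ⟨α, (i', s)⟩)ᴴ) := by
  ext x x'
  simp only [Matrix.sum_apply, Matrix.smul_apply, smul_eq_mul]
  have h : ∀ (α) (i' : Fin (D.dimA₁ α)) (s' : Fin (D.dimA₂ α)),
      (D.isoA * blockDiagonal' (fun α => ρ α ⊗ₖ χ α)) x ⟨α, (i', s')⟩ =
        ∑ i, ∑ s, D.isoA x ⟨α, (i, s)⟩ * (ρ α i i' * χ α s s') := by
    intro α i' s'
    rw [Matrix.mul_apply, Fintype.sum_sigma, Finset.sum_eq_single α]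
    · rw [Fintype.sum_prod_type]
      simp
    · intro β _ hβ
      refine Finset.sum_eq_zero fun y _ => ?_
      rw [blockDiagonal'_apply_ne _ _ _ hβ, mul_zero]
    · simp
  rw [Matrix.mul_apply, Fintype.sum_sigma]
  refine Finset.sum_congr rfl fun α _ => ?_
  rw [Fintype.sum_prod_type, Finset.sum_comm]
  simp only [h, Matrix.mul_apply, Finset.sum_mul, Finset.mul_sum, Matrix.of_apply,
    conjTranspose_apply]
  rw [Finset.sum_comm' (t' := Finset.univ) (s' := fun _ => Finset.univ) (by simp)]
  conv_rhs => rw [Finset.sum_comm]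
  refine Finset.sum_congr rfl fun i' _ => ?_
  rw [Finset.sum_comm]
  refine Finset.sum_congr rfl fun i _ => ?_
  refine Finset.sum_congr rfl fun s' _ => Finset.sum_congr rfl fun s _ => ?_
  ring

/-- The reduced state on `A` of an encoded state is `⨁_α ρ_α ⊗ χ_α`, embedded by `U_A`. The
coherences between blocks and those within `H_{ā^α}` are traced out because `U_Ā` is an isometry.
-/
theorem partialTrace_encoded (ρ : Matrix (Fin K) (Fin K) ℂ) :
    partialTrace A (V * ρ * Vᴴ) =
      D.isoA * blockDiagonal' (fun α => D.block ρ α ⊗ₖ D.reducedχ α) * D.isoAᴴ := by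
  have hρ : V * ρ * Vᴴ = (V * D.basis) * (D.basisᴴ * ρ * D.basis) * (V * D.basis)ᴴ := by
    calc V * ρ * Vᴴ = V * ((D.basis * D.basisᴴ) * ρ * (D.basis * D.basisᴴ)) * Vᴴ := by
          rw [D.basis_complete, Matrix.one_mul, Matrix.mul_one]
      _ = _ := by simp only [conjTranspose_mul, Matrix.mul_assoc]
  rw [hρ, partialTrace_mul_mul_conjTranspose, isoA_mul_blockDiagonal'_mul, Fintype.sum_sigma]
  refine Finset.sum_congr rfl fun α _ => ?_
  rw [Fintype.sum_prod_type]
  refine Finset.sum_congr rfl fun i _ => ?_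
  have hterm : ∀ j, ∑ y', (D.basisᴴ * ρ * D.basis) ⟨α, (i, j)⟩ y' •
      ((unvec A fun x => (V * D.basis) x ⟨α, (i, j)⟩) *
        (unvec A fun x => (V * D.basis) x y')ᴴ) =
      ∑ i', (D.basisᴴ * ρ * D.basis) ⟨α, (i, j)⟩ ⟨α, (i', j)⟩ •
        ((Matrix.of fun x s => D.isoA x ⟨α, (i, s)⟩) * D.reducedχ α *
          (Matrix.of fun x s => D.isoA x ⟨α, (i', s)⟩)ᴴ) := by
    intro j
    rw [Fintype.sum_sigma, Finset.sum_eq_single α]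
    · rw [Fintype.sum_prod_type]
      refine Finset.sum_congr rfl fun i' _ => ?_
      rw [Finset.sum_eq_single j]
      · rw [unvec_encoded_mul_conjTranspose]
        have h1 : (Matrix.of fun t t' =>
            (1 : Matrix (Σ α, Fin (D.dimB₁ α) × Fin (D.dimB₂ α))
              (Σ α, Fin (D.dimB₁ α) × Fin (D.dimB₂ α)) ℂ) ⟨α, (j, t)⟩ ⟨α, (j, t')⟩) = 1 := by
          ext t t'
          simp [Matrix.one_apply]
        rw [h1, Matrix.mul_one, ← reducedχ_eq]
      · intro j' _ hj'
        rw [unvec_encoded_mul_conjTranspose]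
        have h1 : (Matrix.of fun t t' =>
            (1 : Matrix (Σ α, Fin (D.dimB₁ α) × Fin (D.dimB₂ α))
              (Σ α, Fin (D.dimB₁ α) × Fin (D.dimB₂ α)) ℂ) ⟨α, (j, t)⟩ ⟨α, (j', t')⟩) = 0 := by
          ext t t'
          simp [hj'.symm]
        rw [h1]
        simp
      · simp
    · rintro β - hβ
      refine Finset.sum_eq_zero ?_
      rintro ⟨i', j'⟩ -
      rw [unvec_encoded_mul_conjTranspose]
      have h1 : (Matrix.of fun t t' =>
          (1 : Matrix (Σ α, Fin (D.dimB₁ α) × Fin (D.dimB₂ α))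
            (Σ α, Fin (D.dimB₁ α) × Fin (D.dimB₂ α)) ℂ) ⟨α, (j, t)⟩ ⟨β, (j', t')⟩) = 0 := by
        ext t t'
        simp [hβ.symm]
      rw [h1]
      simp
    · simp
  simp only [hterm]
  rw [Finset.sum_comm]
  refine Finset.sum_congr rfl fun i' _ => ?_
  rw [← Finset.sum_smul]
  rfl

theorem entropy_partialTrace {ρ : Matrix (Fin K) (Fin K) ℂ} (hρ : ρ.IsHermitian) :
    (entropy (partialTrace A (V * ρ * Vᴴ)) : ℂ) =
      (D.algebraicEntropy ρ : ℂ) + (D.areaOperator * ρ).trace := by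
  rw [D.partialTrace_encoded, entropy_blockDiagonal'_kronecker _ D.isoA_isometry _ _
    (D.block_isHermitian hρ) D.reducedχ_isHermitian D.trace_reducedχ, Finset.sum_add_distrib,
    Complex.ofReal_add, algebraicEntropy]
  congr 1
  have h1 : (D.areaOperator * ρ).trace =
      ((Matrix.diagonal fun k : Σ α, Fin (D.dimA₁ α) × Fin (D.dimB₁ α) =>
        (entropy (D.reducedχ k.1) : ℂ)) * (D.basisᴴ * ρ * D.basis)).trace := by
    rw [areaOperator, Matrix.mul_assoc, Matrix.mul_assoc, Matrix.trace_mul_comm]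
    simp only [Matrix.mul_assoc]
  rw [h1]
  simp only [Matrix.trace, Matrix.diag, diagonal_mul]
  rw [Fintype.sum_sigma, Complex.ofReal_sum]
  refine Finset.sum_congr rfl fun α _ => ?_
  have h2 : (((D.block ρ α).trace.re : ℝ) : ℂ) = (D.block ρ α).trace := by
    rw [← Complex.conj_eq_iff_re, ← Complex.star_def, ← trace_conjTranspose,
      (D.block_isHermitian hρ α).eq]
  have h3 : (D.block ρ α).trace =
      ∑ i, ∑ j, (D.basisᴴ * ρ * D.basis) ⟨α, (i, j)⟩ ⟨α, (i, j)⟩ := rfl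
  rw [Complex.ofReal_mul]
  refine (congrArg (fun z => z * (entropy (D.reducedχ α) : ℂ)) (h2.trans h3)).trans ?_
  rw [mul_comm, Fintype.sum_prod_type]
  simp only [Finset.mul_sum]

end Decomposition

end ReducedState

/-! ### Block dimensions and the area constant -/

section AreaConstant

variable {q n : ℕ} [NeZero q] {S : Subgroup (Matrix.unitaryGroup (Config q (Fin n)) ℂ)}
  {K : ℕ} {V : Matrix (Config q (Fin n)) (Fin K) ℂ} {A : Finset (Fin n)}

variable (V A) in
open scoped Classical in
/-- Labels of the Weyl operators acting on the code as elements of `M_A`. -/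
noncomputable def algebraLabels : Finset (Config q (Fin n) × Config q (Fin n)) :=
  {l | IsLogical V (weyl l) ∧ Vᴴ * weyl l * V ∈ codeAlgebra V A}

variable (V A) in
/-- Labels of the Weyl operators acting on the code as elements of the center of `M_A`. -/
noncomputable def centerLabels : Finset (Config q (Fin n) × Config q (Fin n)) :=
  algebraLabels V A ∩ algebraLabels V Aᶜ

theorem mem_algebraLabels {l : Config q (Fin n) × Config q (Fin n)} :
    l ∈ algebraLabels V A ↔ IsLogical V (weyl l) ∧ Vᴴ * weyl l * V ∈ codeAlgebra V A := by
  simp [algebraLabels]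

theorem logical_weyl_mem (hS : S ≤ pauliGroup q n) (hV : IsEncoding S V)
    (k : Config q A × Config q A) : Vᴴ * weyl (extendLabel A k) * V ∈ codeAlgebra V A := by
  rw [← localOp_weyl]
  exact (mem_codeAlgebra_iff hS hV).2 ⟨_, rfl⟩

/-- `M_A` is cut out by commutation with the logical Weyl operators supported on `Ā`. -/
theorem mem_codeAlgebra_iff_commute_weyl (hS : S ≤ pauliGroup q n) (hV : IsEncoding S V)
    {X : Matrix (Fin K) (Fin K) ℂ} :
    X ∈ codeAlgebra V A ↔ ∀ k ∈ Set.range (extendLabel (q := q) Aᶜ),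
      Vᴴ * weyl k * V * X = X * (Vᴴ * weyl k * V) := by
  rw [mem_codeAlgebra_iff_commute_compl hS hV]
  constructor
  · rintro h _ ⟨k, rfl⟩
    exact h _ (logical_weyl_mem hS hV k)
  · intro h T hT
    exact commute_codeAlgebra hS hV (fun k => h _ ⟨k, rfl⟩) hT

theorem sum_algebraLabels (hS : S ≤ pauliGroup q n) (hV : IsEncoding S V)
    {X : Matrix (Fin K) (Fin K) ℂ} (hX : X ∈ codeAlgebra V A) :
    ∑ l ∈ algebraLabels V A, ((Vᴴ * weyl l * V)ᴴ * X).trace • (Vᴴ * weyl l * V) =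
      (q : ℂ) ^ n • X :=
  sum_trace_smul_logical hS hV (Set.range (extendLabel Aᶜ)) _
    (fun _ => mem_algebraLabels.trans (and_congr_right fun _ =>
      mem_codeAlgebra_iff_commute_weyl hS hV))
    ((mem_codeAlgebra_iff_commute_weyl hS hV).1 hX)

theorem sum_centerLabels (hS : S ≤ pauliGroup q n) (hV : IsEncoding S V)
    {X : Matrix (Fin K) (Fin K) ℂ} (hX : X ∈ codeAlgebra V A) (hX' : X ∈ codeAlgebra V Aᶜ) :
    ∑ l ∈ centerLabels V A, ((Vᴴ * weyl l * V)ᴴ * X).trace • (Vᴴ * weyl l * V) =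
      (q : ℂ) ^ n • X := by
  refine sum_trace_smul_logical hS hV
    (Set.range (extendLabel Aᶜ) ∪ Set.range (extendLabel Aᶜᶜ)) _ (fun l => ?_) ?_
  · rw [centerLabels, Finset.mem_inter, mem_algebraLabels, mem_algebraLabels,
      mem_codeAlgebra_iff_commute_weyl hS hV, mem_codeAlgebra_iff_commute_weyl hS hV]
    constructor
    · rintro ⟨⟨h1, h2⟩, -, h3⟩
      exact ⟨h1, fun k hk => hk.elim (h2 k) (h3 k)⟩
    · rintro ⟨h1, h2⟩
      exact ⟨⟨h1, fun k hk => h2 k (Or.inl hk)⟩, h1, fun k hk => h2 k (Or.inr hk)⟩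
  · rintro k (hk | hk)
    exacts [(mem_codeAlgebra_iff_commute_weyl hS hV).1 hX k hk,
      (mem_codeAlgebra_iff_commute_weyl hS hV).1 hX' k hk]

namespace Decomposition

variable (D : Decomposition V A)

/-- The element `⨁_α O_α ⊗ 1` of `M_A`. -/
noncomputable def ofBlocks (O : ∀ α, Matrix (Fin (D.dimA₁ α)) (Fin (D.dimA₁ α)) ℂ) :
    Matrix (Fin K) (Fin K) ℂ :=
  D.basis * (blockDiagonal' fun α => O α ⊗ₖ
    (1 : Matrix (Fin (D.dimB₁ α)) (Fin (D.dimB₁ α)) ℂ)) * D.basisᴴ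

theorem mem_codeAlgebra_iff_ofBlocks {T : Matrix (Fin K) (Fin K) ℂ} :
    T ∈ codeAlgebra V A ↔ ∃ O, T = D.ofBlocks O := by
  rw [D.mem_algebra]
  refine exists_congr fun O => ⟨fun h => ?_, fun h => ?_⟩
  · rw [ofBlocks, ← h, Matrix.mul_assoc, D.basis_complete, Matrix.mul_one]
  · rw [h, ofBlocks, Matrix.mul_assoc, D.basis_orthonormal, Matrix.mul_one]

theorem ofBlocks_mul (O O' : ∀ α, Matrix (Fin (D.dimA₁ α)) (Fin (D.dimA₁ α)) ℂ) :
    D.ofBlocks O * D.ofBlocks O' = D.ofBlocks fun α => O α * O' α := by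
  have h : (blockDiagonal' fun α => (O α * O' α) ⊗ₖ
      (1 : Matrix (Fin (D.dimB₁ α)) (Fin (D.dimB₁ α)) ℂ)) =
      (blockDiagonal' fun α => O α ⊗ₖ (1 : Matrix (Fin (D.dimB₁ α)) (Fin (D.dimB₁ α)) ℂ)) *
      (blockDiagonal' fun α => O' α ⊗ₖ (1 : Matrix (Fin (D.dimB₁ α)) (Fin (D.dimB₁ α)) ℂ)) := by
    rw [← blockDiagonal'_mul]
    simp only [← mul_kronecker_mul, Matrix.mul_one]
  simp only [ofBlocks, h, Matrix.mul_assoc]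
  rw [← Matrix.mul_assoc D.basisᴴ, D.basis_orthonormal, Matrix.one_mul]

theorem ofBlocks_conjTranspose (O : ∀ α, Matrix (Fin (D.dimA₁ α)) (Fin (D.dimA₁ α)) ℂ) :
    (D.ofBlocks O)ᴴ = D.ofBlocks fun α => (O α)ᴴ := by
  simp only [ofBlocks, conjTranspose_mul, conjTranspose_conjTranspose,
    blockDiagonal'_conjTranspose, conjTranspose_kronecker, conjTranspose_one, Matrix.mul_assoc]

theorem trace_ofBlocks (O : ∀ α, Matrix (Fin (D.dimA₁ α)) (Fin (D.dimA₁ α)) ℂ) :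
    (D.ofBlocks O).trace = ∑ α, (D.dimB₁ α : ℂ) * (O α).trace := by
  rw [ofBlocks, Matrix.mul_assoc, Matrix.trace_mul_comm, Matrix.mul_assoc, D.basis_orthonormal,
    Matrix.mul_one, trace_blockDiagonal']
  refine Finset.sum_congr rfl fun α _ => ?_
  rw [trace_kronecker, trace_one, Fintype.card_fin, mul_comm]

theorem ofBlocks_entry (O : ∀ α, Matrix (Fin (D.dimA₁ α)) (Fin (D.dimA₁ α)) ℂ)
    (α : Fin D.numBlocks) (i i' : Fin (D.dimA₁ α)) (j : Fin (D.dimB₁ α)) :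
    (D.basisᴴ * D.ofBlocks O * D.basis) ⟨α, (i, j)⟩ ⟨α, (i', j)⟩ = O α i i' := by
  have h : D.basisᴴ * D.ofBlocks O * D.basis = blockDiagonal' fun α => O α ⊗ₖ
      (1 : Matrix (Fin (D.dimB₁ α)) (Fin (D.dimB₁ α)) ℂ) := by
    simp only [ofBlocks, Matrix.mul_assoc, D.basis_orthonormal, Matrix.mul_one]
    rw [← Matrix.mul_assoc, D.basis_orthonormal, Matrix.one_mul]
  rw [h]
  simp

theorem ofBlocks_injective : Function.Injective D.ofBlocks := by
  intro O O' h
  funext α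
  ext i i'
  rw [← D.ofBlocks_entry O α i i' ⟨0, D.dimB₁_pos α⟩, h, D.ofBlocks_entry]

theorem ofBlocks_one : (D.ofBlocks fun _ => 1) = 1 := by
  rw [ofBlocks]
  simp only [one_kronecker_one]
  have h : (blockDiagonal' fun α => (1 : Matrix (Fin (D.dimA₁ α) × Fin (D.dimB₁ α))
    (Fin (D.dimA₁ α) × Fin (D.dimB₁ α)) ℂ)) = 1 := blockDiagonal'_one
  rw [h, Matrix.mul_one, D.basis_complete]

/-- A tight frame of logical operators restricts to one in each block. -/
theorem sum_block_frame {κ : Type*} (F : Finset κ) (T : κ → Matrix (Fin K) (Fin K) ℂ)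
    (u : κ → ∀ α, Matrix (Fin (D.dimA₁ α)) (Fin (D.dimA₁ α)) ℂ)
    (hT : ∀ l ∈ F, T l = D.ofBlocks (u l)) {c : ℂ} {α : Fin D.numBlocks}
    {Y : Matrix (Fin (D.dimA₁ α)) (Fin (D.dimA₁ α)) ℂ}
    (h : ∑ l ∈ F, ((T l)ᴴ * D.ofBlocks (Pi.single α Y)).trace • T l =
      c • D.ofBlocks (Pi.single α Y)) :
    ∑ l ∈ F, ((D.dimB₁ α : ℂ) * ((u l α)ᴴ * Y).trace) • u l α = c • Y := by
  have htr : ∀ l ∈ F, ((T l)ᴴ * D.ofBlocks (Pi.single α Y)).trace =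
      (D.dimB₁ α : ℂ) * ((u l α)ᴴ * Y).trace := by
    intro l hl
    rw [hT l hl, ofBlocks_conjTranspose, ofBlocks_mul, trace_ofBlocks, Finset.sum_eq_single α]
    · rw [Pi.single_eq_same]
    · intro β _ hβ
      rw [Pi.single_eq_of_ne hβ, Matrix.mul_zero, trace_zero, mul_zero]
    · simp
  have h1 := congrArg (fun Z => D.basisᴴ * Z * D.basis) h
  ext i i'
  have h2 := congrFun (congrFun h1 ⟨α, (i, ⟨0, D.dimB₁_pos α⟩)⟩) ⟨α, (i', ⟨0, D.dimB₁_pos α⟩)⟩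
  simp only [Matrix.mul_sum, Matrix.sum_mul, Matrix.mul_smul, Matrix.smul_mul, Matrix.sum_apply,
    Matrix.smul_apply] at h2
  rw [ofBlocks_entry, Pi.single_eq_same] at h2
  rw [Matrix.sum_apply, Matrix.smul_apply, ← h2]
  refine Finset.sum_congr rfl fun l hl => ?_
  rw [htr l hl, hT l hl, ofBlocks_entry, Matrix.smul_apply]

/-- The ratio of the two dimensions of a block does not depend on the block: expand the matrix units
of the block in the frame of logical Weyl operators in `M_A` and sum over a row, using that the
logical Weyl operators are unitary. -/
theorem dimB₁_mul_card_algebraLabels (hS : S ≤ pauliGroup q n) (hV : IsEncoding S V)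
    (α : Fin D.numBlocks) :
    D.dimB₁ α * (algebraLabels V A).card = q ^ n * D.dimA₁ α := by
  have hex : ∀ l ∈ algebraLabels V A, ∃ u, Vᴴ * weyl l * V = D.ofBlocks u := fun l hl =>
    D.mem_codeAlgebra_iff_ofBlocks.1 (mem_algebraLabels.1 hl).2
  choose! u hu using hex
  have huu : ∀ l ∈ algebraLabels V A, u l α * (u l α)ᴴ = 1 := by
    intro l hl
    have h1 := (mem_algebraLabels.1 hl).1.logical_mul_conjTranspose hV.isometry
      (weyl_mul_conjTranspose_self l)
    rw [hu l hl, ofBlocks_conjTranspose, ofBlocks_mul, ← D.ofBlocks_one] at h1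
    exact congrFun (D.ofBlocks_injective h1) α
  set i : Fin (D.dimA₁ α) := ⟨0, D.dimA₁_pos α⟩
  have hentry : ∀ i', ∑ l ∈ algebraLabels V A,
      (D.dimB₁ α : ℂ) * (u l α i i' * star (u l α i i')) = (q : ℂ) ^ n := by
    intro i'
    have h1 := D.sum_block_frame _ _ u hu (sum_algebraLabels hS hV
      (D.mem_codeAlgebra_iff_ofBlocks.2 ⟨Pi.single α (Matrix.single i i' 1), rfl⟩))
    have h2 := congrFun (congrFun h1 i) i'
    rw [Matrix.sum_apply, Matrix.smul_apply, Matrix.single_apply_same, smul_eq_mul,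
      mul_one] at h2
    rw [← h2]
    refine Finset.sum_congr rfl fun l _ => ?_
    rw [Matrix.smul_apply, smul_eq_mul, trace_mul_single, conjTranspose_apply]
    simp
    ring
  have hsum := Finset.sum_congr (rfl : (Finset.univ : Finset (Fin (D.dimA₁ α))) = _)
    fun i' _ => hentry i'
  rw [Finset.sum_comm, Finset.sum_const, Finset.card_univ, Fintype.card_fin] at hsum
  have hl : ∀ l ∈ algebraLabels V A,
      ∑ i', (D.dimB₁ α : ℂ) * (u l α i i' * star (u l α i i')) = D.dimB₁ α := by
    intro l hl
    have h1 := congrFun (congrFun (huu l hl) i) i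
    rw [Matrix.mul_apply, one_apply_eq] at h1
    rw [← Finset.mul_sum]
    simp only [conjTranspose_apply] at h1
    rw [h1, mul_one]
  rw [Finset.sum_congr rfl hl, Finset.sum_const] at hsum
  simp only [nsmul_eq_mul] at hsum
  have h3 : (algebraLabels V A).card * D.dimB₁ α = D.dimA₁ α * q ^ n := by exact_mod_cast hsum
  rw [mul_comm, h3, mul_comm]

/-- The product of the two dimensions of a block does not depend on the block: expand the projection
onto the block in the frame of central logical Weyl operators, each of which is a phase there. -/
theorem card_centerLabels_mul (hS : S ≤ pauliGroup q n) (hV : IsEncoding S V)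
    (α : Fin D.numBlocks) :
    (centerLabels V A).card * (D.dimA₁ α * D.dimB₁ α) = q ^ n := by
  have hmem : ∀ l ∈ centerLabels V A, l ∈ algebraLabels V A ∧ l ∈ algebraLabels V Aᶜ :=
    fun l hl => Finset.mem_inter.1 hl
  have hex : ∀ l ∈ centerLabels V A, ∃ u, Vᴴ * weyl l * V = D.ofBlocks u := fun l hl =>
    D.mem_codeAlgebra_iff_ofBlocks.1 (mem_algebraLabels.1 (hmem l hl).1).2
  choose! u hu using hex
  have huu : ∀ l ∈ centerLabels V A, u l α * (u l α)ᴴ = 1 := by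
    intro l hl
    have h1 := (mem_algebraLabels.1 (hmem l hl).1).1.logical_mul_conjTranspose hV.isometry
      (weyl_mul_conjTranspose_self l)
    rw [hu l hl, ofBlocks_conjTranspose, ofBlocks_mul, ← D.ofBlocks_one] at h1
    exact congrFun (D.ofBlocks_injective h1) α
  set i : Fin (D.dimA₁ α) := ⟨0, D.dimA₁_pos α⟩
  -- a central element is a scalar in each block
  have hscal : ∀ l ∈ centerLabels V A, ∃ c : ℂ, u l α = c • 1 := by
    intro l hl
    have hcomm : ∀ Y, Y * u l α = u l α * Y := by
      intro Y
      have h1 := commute_codeAlgebra_compl hV.isometry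
        (D.mem_codeAlgebra_iff_ofBlocks.2 ⟨Pi.single α Y, rfl⟩)
        (mem_algebraLabels.1 (hmem l hl).2).2
      rw [hu l hl, ofBlocks_mul, ofBlocks_mul] at h1
      have h2 := congrFun (D.ofBlocks_injective h1) α
      simpa using h2
    obtain ⟨c, hc⟩ := Matrix.mem_range_scalar_of_commute_single (M := u l α)
      fun i j _ => hcomm _
    exact ⟨c, by rw [← hc, smul_one_eq_diagonal, scalar_apply]⟩
  have hPA : D.ofBlocks (Pi.single α 1) ∈ codeAlgebra V A :=
    D.mem_codeAlgebra_iff_ofBlocks.2 ⟨_, rfl⟩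
  have hPB : D.ofBlocks (Pi.single α 1) ∈ codeAlgebra V Aᶜ := by
    rw [mem_codeAlgebra_compl_iff hS hV]
    intro X hX
    obtain ⟨O, rfl⟩ := D.mem_codeAlgebra_iff_ofBlocks.1 hX
    rw [ofBlocks_mul, ofBlocks_mul]
    congr 1
    funext β
    by_cases hβ : β = α
    · subst hβ
      simp
    · simp [Pi.single_eq_of_ne hβ]
  have h1 := D.sum_block_frame _ _ u hu (sum_centerLabels hS hV hPA hPB)
  have h2 := congrFun (congrFun h1 i) i
  rw [Matrix.sum_apply, Matrix.smul_apply, one_apply_eq, smul_eq_mul, mul_one] at h2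
  have hl : ∀ l ∈ centerLabels V A,
      (((D.dimB₁ α : ℂ) * ((u l α)ᴴ * 1).trace) • u l α) i i = D.dimB₁ α * D.dimA₁ α := by
    intro l hl
    obtain ⟨c, hc⟩ := hscal l hl
    have h3 := congrFun (congrFun (huu l hl) i) i
    rw [hc] at h3 ⊢
    simp only [conjTranspose_smul, conjTranspose_one, smul_mul_smul_comm, Matrix.mul_one,
      Matrix.smul_apply, one_apply_eq, smul_eq_mul] at h3
    simp only [conjTranspose_smul, conjTranspose_one, Matrix.mul_one, Matrix.smul_apply,
      one_apply_eq, smul_eq_mul, trace_smul, trace_one, Fintype.card_fin]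
    linear_combination (D.dimB₁ α : ℂ) * D.dimA₁ α * h3
  rw [Finset.sum_congr rfl hl, Finset.sum_const, nsmul_eq_mul] at h2
  have h4 : (centerLabels V A).card * (D.dimB₁ α * D.dimA₁ α) = q ^ n := by exact_mod_cast h2
  rw [mul_comm (D.dimA₁ α), h4]

theorem block_one (α : Fin D.numBlocks) : D.block 1 α = (D.dimB₁ α : ℂ) • 1 := by
  ext i i'
  rw [block, Matrix.of_apply, Matrix.mul_one, D.basis_orthonormal]
  by_cases h : i = i'
  · subst h
    simp
  · simp [h]

/-- Since `Tr_Ā (V Vᴴ) = ⨁_α dim H_{ā^α} (1 ⊗ χ_α)` has a flat spectrum, so does each `χ_α`. -/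
theorem reducedχ_sq (hS : S ≤ pauliGroup q n) (hV : IsEncoding S V) (α : Fin D.numBlocks) :
    D.reducedχ α * D.reducedχ α =
      ((flatness V A / D.dimB₁ α : ℝ) : ℂ) • D.reducedχ α := by
  have hR := D.partialTrace_encoded 1
  rw [Matrix.mul_one] at hR
  have hsq := partialTrace_codeProjection_sq (A := A) hS hV
  rw [hR] at hsq
  set Z := blockDiagonal' (fun α => D.block 1 α ⊗ₖ D.reducedχ α) with hZ
  have hZZ : Z * Z = (flatness V A : ℂ) • Z := by
    have h1 := congrArg (fun Y => D.isoAᴴ * Y * D.isoA) hsq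
    have h2 : D.isoAᴴ * (D.isoA * Z * D.isoAᴴ * (D.isoA * Z * D.isoAᴴ)) * D.isoA =
        (D.isoAᴴ * D.isoA) * Z * (D.isoAᴴ * D.isoA) * Z * (D.isoAᴴ * D.isoA) := by
      simp only [Matrix.mul_assoc]
    have h3 : D.isoAᴴ * ((flatness V A : ℂ) • (D.isoA * Z * D.isoAᴴ)) * D.isoA =
        (flatness V A : ℂ) • ((D.isoAᴴ * D.isoA) * Z * (D.isoAᴴ * D.isoA)) := by
      simp only [Matrix.mul_smul, Matrix.smul_mul, Matrix.mul_assoc]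
    simp only [h2, h3, D.isoA_isometry, Matrix.one_mul, Matrix.mul_one] at h1
    exact h1
  rw [hZ, ← blockDiagonal'_mul, ← blockDiagonal'_smul] at hZZ
  have hα := congrFun (blockDiagonal'_injective hZZ) α
  simp only [Pi.smul_apply, block_one, ← mul_kronecker_mul, smul_mul_smul_comm, Matrix.mul_one,
    smul_kronecker, smul_smul] at hα
  have hb : (D.dimB₁ α : ℂ) ≠ 0 := Nat.cast_ne_zero.2 (D.dimB₁_pos α).ne'
  ext s s'
  have h := congrFun (congrFun hα (⟨0, D.dimA₁_pos α⟩, s)) (⟨0, D.dimA₁_pos α⟩, s')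
  simp only [Matrix.smul_apply, kroneckerMap_apply, one_apply_eq, one_mul, smul_eq_mul] at h
  rw [Matrix.smul_apply, smul_eq_mul]
  push_cast
  field_simp
  refine mul_left_cancel₀ hb ?_
  linear_combination h

/-- The entropy of `χ_α` in terms of the code and the bipartition alone; the square root is
`dim H_{ā^α}`, obtained from the ratio and the product of the block dimensions. -/
theorem entropy_reducedχ (hS : S ≤ pauliGroup q n) (hV : IsEncoding S V)
    (α : Fin D.numBlocks) :
    entropy (D.reducedχ α) = -Real.log (flatness V A / √((q : ℝ) ^ n * (q : ℝ) ^ n /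
      ((algebraLabels V A).card * (centerLabels V A).card))) := by
  rw [entropy_of_sq_eq_smul (D.reducedχ_isHermitian α) (D.reducedχ_sq hS hV α)
    (D.trace_reducedχ α)]
  have h1 : (D.dimB₁ α : ℝ) * (algebraLabels V A).card = (q : ℝ) ^ n * D.dimA₁ α := by
    exact_mod_cast D.dimB₁_mul_card_algebraLabels hS hV α
  have h2 : ((centerLabels V A).card : ℝ) * (D.dimA₁ α * D.dimB₁ α) = (q : ℝ) ^ n := by
    exact_mod_cast D.card_centerLabels_mul hS hV α
  have hq : (q : ℝ) ^ n ≠ 0 := pow_ne_zero _ (Nat.cast_ne_zero.2 (NeZero.ne q))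
  have ha : (D.dimA₁ α : ℝ) ≠ 0 := Nat.cast_ne_zero.2 (D.dimA₁_pos α).ne'
  have hA : ((algebraLabels V A).card : ℝ) ≠ 0 := by
    intro h0
    rw [h0, mul_zero] at h1
    exact mul_ne_zero hq ha h1.symm
  have hZ : ((centerLabels V A).card : ℝ) ≠ 0 := by
    intro h0
    rw [h0, zero_mul] at h2
    exact hq h2.symm
  have hb : √((q : ℝ) ^ n * (q : ℝ) ^ n /
      ((algebraLabels V A).card * (centerLabels V A).card)) = D.dimB₁ α := by
    rw [Real.sqrt_eq_iff_mul_self_eq (by positivity) (by positivity),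
      div_eq_iff (mul_ne_zero hA hZ)]
    linear_combination -((D.dimB₁ α : ℝ) * (centerLabels V A).card * h1) - (q : ℝ) ^ n * h2
  rw [hb]

theorem areaOperator_eq_smul {c : ℝ} (h : ∀ α, entropy (D.reducedχ α) = c) :
    D.areaOperator = (c : ℂ) • 1 := by
  rw [areaOperator]
  simp only [h]
  rw [← smul_one_eq_diagonal, Matrix.mul_smul, Matrix.smul_mul, Matrix.mul_one, D.basis_complete]

end Decomposition

end AreaConstant

end PauliCode

theorem theorem1 (q n : ℕ) [NeZero q]
    (S : Subgroup (Matrix.unitaryGroup (PauliCode.Config q (Fin n)) ℂ))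
    (hS : S ≤ PauliCode.pauliGroup q n)
    (hcomm : ∀ U ∈ S, ∀ W ∈ S, U * W = W * U)
    (K : ℕ) (V : Matrix (PauliCode.Config q (Fin n)) (Fin K) ℂ)
    (hV : PauliCode.IsEncoding S V)
    (A : Finset (Fin n)) :
    -- complementary recovery holds: the commutant of `M_A` is `M_Ā`
    StarSubalgebra.centralizer ℂ
        (PauliCode.codeAlgebra V A : Set (Matrix (Fin K) (Fin K) ℂ)) =
      PauliCode.codeAlgebra V Aᶜ ∧
    -- a decomposition defining an area operator exists
    Nonempty (PauliCode.Decomposition V A) ∧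
    -- the area operator is the one in the Ryu–Takayanagi type formula
    (∀ (D : PauliCode.Decomposition V A) (ρ : Matrix (Fin K) (Fin K) ℂ),
      ρ.PosSemidef → ρ.trace = 1 →
        (PauliCode.entropy (PauliCode.partialTrace A (V * ρ * V.conjTranspose)) : ℂ) =
          (D.algebraicEntropy ρ : ℂ) + (D.areaOperator * ρ).trace) ∧
    -- every area operator is one and the same multiple of the logical identity
    ∃ c : ℝ, ∀ D : PauliCode.Decomposition V A,
      D.areaOperator = (c : ℂ) • (1 : Matrix (Fin K) (Fin K) ℂ) :=
  ⟨PauliCode.centralizer_codeAlgebra hS hV, PauliCode.nonempty_decomposition hS hV,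
    fun D _ hρ _ => D.entropy_partialTrace hρ.isHermitian,
    _, fun D => D.areaOperator_eq_smul (D.entropy_reducedχ hS hV)⟩
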